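/- Positions and entries of a permutation of length $n$ are $1,\dots,n$. A complete Baxter permutation is a permutation $w$ of length $2n+1$ such that $w(i)$ is even if and only if $i$ is even, and such that every entry of $w$ that lies (in position) between the entries $i$ and $i+1$ is smaller than $i$ if $i$ is odd, and larger than $i+1$ if $i$ is even. If a permutation $\pi$ preserves parity, write $\pi^o$ and $\pi^e$ for the permutations it induces on its odd and on its even entries, that is, $\pi(2j-1)=2\pi^o(j)-1$ and $\pi(2j)=2\pi^e(j)$. A snow leopard permutation is a permutation $w^e$, where $w$ is a complete Baxter permutation such that $w^o$ and its inverse are both alternating (their ascents and descents alternate, starting with an ascent). Snow leopard permutations preserve parity. An even thread (odd thread) is a permutation of the form $\pi^e$ ($\pi^o$) for a snow leopard permutation $\pi$ of odd length; an even thread $\alpha$ and an odd thread $\beta$ are entangled if $\alpha=\pi^e$ and $\beta=\pi^o$ for one and the same snow leopard permutation $\pi$ of odd length. The Motzkin numbers are given by $M_0=1$ and $M_n=M_{n-1}+\sum_{k=2}^n M_{k-2}M_{n-k}$ for $n\ge 1$. For permutations $\pi$ of length $n$ and $\sigma$ of length $m$, let $\pi\oplus\sigma$ be $\pi$ followed by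 $\sigma$ with its entries raised by $n$, and let $\pi\ominus\sigma$ be $\pi$ with its entries raised by $m$, followed by $\sigma$. For positive integers $l_1,\dots,l_m$ with $m\ge1$, let $U_{l_1,\dots,l_m}=I_{l_1}\ominus\cdots\ominus I_{l_m}$ and $D_{l_1,\dots,l_m}=J_{l_1}\oplus\cdots\oplus J_{l_m}$, where $I_l=1\,2\cdots l$ and $J_l=l\cdots 2\,1$. Theorem. (a) For all $m\ge1$ and all positive integers $l_1,\dots,l_m$, the permutation $U_{l_1,\dots,l_m}$ is an odd thread, and there are exactly $M_{l_1-1}\cdots M_{l_m-1}$ even threads entangled with it. (b) For all $m\ge2$ and all positive integers $l_1,\dots,l_m$, the permutation $D_{l_1,\dots,l_m}$ is an even thread, and there are exactly $M_{l_1-1}\cdots M_{l_m-1}$ odd threads entangled with it. For $m=1$ and any positive integer $l$, the permutation $D_l$ is an even thread, and there are exactly $M_{l+1}$ odd threads entangled with it. -/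

import Mathlib

namespace SnowLeopard

open Equiv

/- Permutations of length `n` are elements of `Perm (Fin n)`, so positions and values are
`0, …, n - 1` instead of `1, …, n`: an entry that is odd in one-line notation `1, …, n` is
an even element of `Fin n`, and conversely. -/

/-- Complete Baxter permutations of length `2 * n + 1`: parity is preserved, and the entries
between the consecutive values `i` and `i + 1` are all smaller than `i` if `i` is odd and all larger
than `i + 1` if `i` is even (parities of values counted from `1`). -/
def IsCompleteBaxter {n : ℕ} (w : Perm (Fin (2 * n + 1))) : Prop :=
  (∀ x, Even (w x : ℕ) ↔ Even (x : ℕ)) ∧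
  ∀ x y z, (w y : ℕ) = (w x : ℕ) + 1 → (x < z ∧ z < y ∨ y < z ∧ z < x) →
    (Even (w x : ℕ) → w z < w x) ∧ (Odd (w x : ℕ) → w y < w z)

/-- `σ` is the permutation that the parity-preserving permutation `π` induces on its odd entries
(counted from `1`): `π (2 j - 1) = 2 σ(j) - 1`. -/
def InducesOnOdd {n k : ℕ} (π : Perm (Fin n)) (σ : Perm (Fin k)) : Prop :=
  k = (n + 1) / 2 ∧
    ∀ (j : Fin k) (i : Fin n), (i : ℕ) = 2 * (j : ℕ) → (π i : ℕ) = 2 * (σ j : ℕ)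

/-- `σ` is the permutation that the parity-preserving permutation `π` induces on its even entries
(counted from `1`): `π (2 j) = 2 σ(j)`. -/
def InducesOnEven {n k : ℕ} (π : Perm (Fin n)) (σ : Perm (Fin k)) : Prop :=
  k = n / 2 ∧
    ∀ (j : Fin k) (i : Fin n), (i : ℕ) = 2 * (j : ℕ) + 1 → (π i : ℕ) = 2 * (σ j : ℕ) + 1

/-- (Reduced) Baxter permutations. -/
def IsBaxter {n : ℕ} (b : Perm (Fin (n + 1))) : Prop :=
  ∃ w : Perm (Fin (2 * n + 1)), IsCompleteBaxter w ∧ InducesOnOdd w b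

/-- Anti-Baxter permutations. -/
def IsAntiBaxter {n : ℕ} (a : Perm (Fin n)) : Prop :=
  ∃ w : Perm (Fin (2 * n + 1)), IsCompleteBaxter w ∧ InducesOnEven w a

/-- Compatibility of a Baxter permutation of length `n + 1` and an anti-Baxter permutation of
length `n`: they are induced by a common complete Baxter permutation. -/
def Compatible {n : ℕ} (b : Perm (Fin (n + 1))) (a : Perm (Fin n)) : Prop :=
  ∃ w : Perm (Fin (2 * n + 1)), IsCompleteBaxter w ∧ InducesOnOdd w b ∧ InducesOnEven w a

/-- Alternating (up-down) permutations: ascents and descents alternate, starting with an ascent. -/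
def IsAlternating {n : ℕ} (π : Perm (Fin n)) : Prop :=
  ∀ i j : Fin n, (j : ℕ) = (i : ℕ) + 1 →
    (Even (i : ℕ) → π i < π j) ∧ (Odd (i : ℕ) → π j < π i)

/-- Doubly alternating permutations. -/
def IsDoublyAlternating {n : ℕ} (π : Perm (Fin n)) : Prop :=
  IsAlternating π ∧ IsAlternating π⁻¹

/-- Snow leopard permutations: anti-Baxter permutations compatible with a doubly alternating Baxter
permutation. -/
def IsSnowLeopard {n : ℕ} (a : Perm (Fin n)) : Prop :=
  IsAntiBaxter a ∧
    ∃ b : Perm (Fin (n + 1)), IsBaxter b ∧ IsDoublyAlternating b ∧ Compatible b a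

/-- Even threads: permutations induced on the even entries of a snow leopard permutation of odd
length. -/
def IsEvenThread {k : ℕ} (α : Perm (Fin k)) : Prop :=
  ∃ (n : ℕ) (π : Perm (Fin (2 * n + 1))), IsSnowLeopard π ∧ InducesOnEven π α

/-- Odd threads: permutations induced on the odd entries of a snow leopard permutation of odd
length. -/
def IsOddThread {k : ℕ} (β : Perm (Fin k)) : Prop :=
  ∃ (n : ℕ) (π : Perm (Fin (2 * n + 1))), IsSnowLeopard π ∧ InducesOnOdd π β

/-- An even thread `α` and an odd thread `β` are entangled: both are induced by a common snow
leopard permutation of odd length. -/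
def Entangled {k l : ℕ} (α : Perm (Fin k)) (β : Perm (Fin l)) : Prop :=
  ∃ (n : ℕ) (π : Perm (Fin (2 * n + 1))),
    IsSnowLeopard π ∧ InducesOnEven π α ∧ InducesOnOdd π β

/-- The direct sum `π ⊕ σ`: first `π`, then `σ` with all values raised by the length of `π`. -/
def directSum {n m : ℕ} (π : Perm (Fin n)) (σ : Perm (Fin m)) : Perm (Fin (n + m)) :=
  (finSumFinEquiv.symm.trans (Equiv.sumCongr π σ)).trans finSumFinEquiv

/-- The skew sum `π ⊖ σ`: first `π` with all values raised by the length of `σ`, then `σ`. -/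
def skewSum {n m : ℕ} (π : Perm (Fin n)) (σ : Perm (Fin m)) : Perm (Fin (n + m)) :=
  (((finSumFinEquiv.symm.trans (Equiv.sumCongr π σ)).trans (Equiv.sumComm _ _)).trans
    finSumFinEquiv).trans (finCongr (Nat.add_comm m n))

/-- The increasing permutation `1 2 ⋯ n`. -/
def incPerm (n : ℕ) : Perm (Fin n) := Equiv.refl _

/-- The decreasing permutation `n ⋯ 2 1`. -/
def decPerm (n : ℕ) : Perm (Fin n) := Fin.revPerm

/-- The up-layered permutation with block lengths `l₁, …, lₘ`: the skew sum of the increasing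
permutations of lengths `l₁, …, lₘ`. -/
def upLayered : (l : List ℕ) → Perm (Fin l.sum)
  | [] => Equiv.refl _
  | k :: l => skewSum (incPerm k) (upLayered l)

/-- The down-layered permutation with block lengths `l₁, …, lₘ`: the direct sum of the decreasing
permutations of lengths `l₁, …, lₘ`. -/
def downLayered : (l : List ℕ) → Perm (Fin l.sum)
  | [] => Equiv.refl _
  | k :: l => directSum (decPerm k) (downLayered l)

/-- The Motzkin numbers: `M 0 = 1` and `M n = M (n - 1) + ∑ k from 2 to n, M (k - 2) * M (n - k)`
for `n ≥ 1`. -/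
def motzkin : ℕ → ℕ
  | 0 => 1
  | n + 1 => motzkin n + ∑ k : Fin n, motzkin k * motzkin (n - 1 - k)

/-- The set of even threads, of any length, entangled with `β`. -/
def evenThreadsEntangledWith {k : ℕ} (β : Perm (Fin k)) : Set (Σ n : ℕ, Perm (Fin n)) :=
  {α | IsEvenThread α.2 ∧ Entangled α.2 β}

/-- The set of odd threads, of any length, entangled with `α`. -/
def oddThreadsEntangledWith {k : ℕ} (α : Perm (Fin k)) : Set (Σ n : ℕ, Perm (Fin n)) :=
  {β | IsOddThread β.2 ∧ Entangled α β.2}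

end SnowLeopard

/-! Frame a complete Baxter permutation by a maximal entry in front and a minimal entry behind. When
its odd entries form a doubly alternating permutation and its length is `4k - 1`, the result is a
bijection `w` of `[0, 4k]` (`IsSnow`), and this class is closed under half-turns (`rot`) and
inversion (`symm`). The odd thread is read off at the positions congruent to 2 mod 4; the multiples
of 4, frame included, carry `1 ⊖ α ⊖ 1` for the even thread `α`.

Such a `w` with `k > 0` begins `4k, v + 1`. The value `v` stands at position `4k - v`, right after
the value `4k - 1` (`corner`, resting on `above`). Hence `w` splits: between `v + 1` and `4k - 1`
lies the complement of a smaller framed permutation, and from `v` onwards another one (`decomp`).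
Any two can be glued back (`exists_glue`). Complementing and shifting by 2 exchanges the residues 0
and 2 mod 4, so on threads the splitting reads `(β₁, α₁), (β₂, α₂) ↦ (α₁ᶜ ⊖ β₂, 1 ⊖ β₁ᶜ ⊖ α₂)`,
starting from the pair (empty, `1`). This is `Threads`.

The rest is counting. As `α₁ᶜ` starts with its minimum, the first entry of `α₁ᶜ ⊖ β₂` gives the
length of `β₂`. So `I_l ⊖ u` forces `α₁ = J_l` and `β₂ = u`, and the count for `U` is a product over
its blocks of the number of partners of `J_l`. On the other side `J_{n+2} = 1 ⊖ J_i ⊖ J_{n+1-i}` may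
be cut at every `i ≤ n`, which is the Motzkin recursion; thus `J_{n+1}` has `M_n` partners. If `D`
has at least two blocks, its first entry is below its last, so `1 ⊖ D ⊖ 1` can only be cut with `α₂
= 1`, and the count is that of `Dᶜ = U`. For one block, `1 ⊖ J_l ⊖ 1 = J_{l+2}` gives `M_{l+1}`. -/

namespace SnowLeopard

/-! ### Framed permutations of `[0, 4k]` and their symmetries -/

/-- `w` and `p` are mutually inverse bijections of `[0, 4 * k]`; the restriction of `w` to
`[1, 4 * k - 1]` is a complete Baxter permutation whose odd entries form a doubly alternating
permutation, framed by the extra entries `w 0 = 4 * k` and `w (4 * k) = 0`. -/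
structure IsSnow (k : ℤ) (w p : ℤ → ℤ) : Prop where
  nonneg : 0 ≤ k
  map : ∀ i, 0 ≤ i → i ≤ 4 * k → 0 ≤ w i ∧ w i ≤ 4 * k
  imap : ∀ i, 0 ≤ i → i ≤ 4 * k → 0 ≤ p i ∧ p i ≤ 4 * k
  left_inv : ∀ i, 0 ≤ i → i ≤ 4 * k → p (w i) = i
  right_inv : ∀ i, 0 ≤ i → i ≤ 4 * k → w (p i) = i
  zero : w 0 = 4 * k
  last : w (4 * k) = 0
  parity : ∀ i, 0 ≤ i → i ≤ 4 * k → w i % 2 = i % 2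
  baxter_odd : ∀ v i, 0 ≤ v → v + 1 ≤ 4 * k → v % 2 = 1 →
    (p v < i ∧ i < p (v + 1) ∨ p (v + 1) < i ∧ i < p v) → w i < v
  baxter_even : ∀ v i, 0 ≤ v → v + 1 ≤ 4 * k → v % 2 = 0 →
    (p v < i ∧ i < p (v + 1) ∨ p (v + 1) < i ∧ i < p v) → v + 1 < w i
  alt : ∀ i, 0 ≤ i → i + 2 ≤ 4 * k →
    (i % 4 = 1 → w i < w (i + 2)) ∧ (i % 4 = 3 → w (i + 2) < w i)
  ialt : ∀ i, 0 ≤ i → i + 2 ≤ 4 * k →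
    (i % 4 = 1 → p i < p (i + 2)) ∧ (i % 4 = 3 → p (i + 2) < p i)

theorem exists_int_crossing {P : ℤ → Prop} {a b : ℤ} (hab : a ≤ b) (ha : P a) (hb : ¬ P b) :
    ∃ u, a ≤ u ∧ u < b ∧ P u ∧ ¬ P (u + 1) := by
  by_contra! h
  have : ∀ n : ℕ, a + n ≤ b → P (a + n) := by
    intro n
    induction n with
    | zero => intro _; simpa using ha
    | succ n ih =>
      intro hn
      push_cast at hn ⊢
      have := h (a + n) (by omega) (by omega) (ih (by omega))
      rwa [← add_assoc]
  apply hb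
  have h2 := this (b - a).toNat (by omega)
  rwa [show a + ((b - a).toNat : ℤ) = b by omega] at h2

namespace IsSnow

variable {k : ℤ} {w p : ℤ → ℤ}

/-- A half-turn reverses all inequalities, but it also changes the parity of the lower of two
consecutive values and swaps the residues 1 and 3 mod 4, so the two Baxter conditions trade places
and alternation survives. -/
theorem rot (h : IsSnow k w p) :
    IsSnow k (fun i => 4 * k - w (4 * k - i)) (fun v => 4 * k - p (4 * k - v)) where
  nonneg := h.nonneg
  map i h0 h1 := by have := h.map (4 * k - i) (by omega) (by omega); omega
  imap i h0 h1 := by have := h.imap (4 * k - i) (by omega) (by omega); omega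
  left_inv i h0 h1 := by
    have := h.left_inv (4 * k - i) (by omega) (by omega); simp only [sub_sub_cancel]; omega
  right_inv i h0 h1 := by
    have := h.right_inv (4 * k - i) (by omega) (by omega); simp only [sub_sub_cancel]; omega
  zero := by simp [h.last]
  last := by simp [h.zero]
  parity i h0 h1 := by have := h.parity (4 * k - i) (by omega) (by omega); omega
  baxter_odd v i h0 h1 hv hb := by
    have := h.baxter_even (4 * k - (v + 1)) (4 * k - i) (by omega) (by omega) (by omega)
    rw [show 4 * k - (v + 1) + 1 = 4 * k - v by ring] at this
    have := this (by omega)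
    omega
  baxter_even v i h0 h1 hv hb := by
    have := h.baxter_odd (4 * k - (v + 1)) (4 * k - i) (by omega) (by omega) (by omega)
    rw [show 4 * k - (v + 1) + 1 = 4 * k - v by ring] at this
    have := this (by omega)
    omega
  alt i h0 h1 := by
    have := h.alt (4 * k - (i + 2)) (by omega) (by omega)
    rw [show 4 * k - (i + 2) + 2 = 4 * k - i by ring] at this
    constructor <;> intro h2
    · have := this.1 (by omega); omega
    · have := this.2 (by omega); omega
  ialt i h0 h1 := by
    have := h.ialt (4 * k - (i + 2)) (by omega) (by omega)
    rw [show 4 * k - (i + 2) + 2 = 4 * k - i by ring] at this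
    constructor <;> intro h2
    · have := this.1 (by omega); omega
    · have := this.2 (by omega); omega

theorem ieven (h : IsSnow k w p) (v : ℤ) (h0 : 0 ≤ v) (h1 : v ≤ 4 * k) : p v % 2 = v % 2 := by
  have h2 := h.imap v h0 h1
  have h3 := h.parity _ h2.1 h2.2
  rw [h.right_inv v h0 h1] at h3
  exact h3.symm

/-- The Baxter condition passes to the inverse. If a value between `w i` and `w (i + 1)` stood right
of them, then on the way from `w i` to it some consecutive values `u`, `u + 1` would lie on
different sides of the gap between positions `i` and `i + 1`. The condition at `u` is then violated
by the entry at `i` if `u` is even and at `i + 1` if `u` is odd; parity keeps that entry strictly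
inside. -/
theorem ibaxter_odd (h : IsSnow k w p) (i v : ℤ) (h0 : 0 ≤ i) (h1 : i + 1 ≤ 4 * k)
    (hi : i % 2 = 1) (hv : w i < v ∧ v < w (i + 1) ∨ w (i + 1) < v ∧ v < w i) : p v < i := by
  have m0 := h.map i h0 (by omega)
  have m1 := h.map (i + 1) (by omega) h1
  have q0 := h.left_inv i h0 (by omega)
  have q1 := h.left_inv (i + 1) (by omega) h1
  have par0 := h.parity i h0 (by omega)
  have rv := h.right_inv v (by omega) (by omega)
  by_contra hc
  have hne : p v ≠ i := by intro e; rw [e] at rv; omega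
  have hne1 : p v ≠ i + 1 := by intro e; rw [e] at rv; omega
  rcases hv with ⟨hv1, hv2⟩ | ⟨hv1, hv2⟩
  · obtain ⟨u, hu1, hu2, hu3, hu4⟩ := exists_int_crossing (P := fun u => p u ≤ i)
      hv1.le (by omega) (by omega)
    have ru := h.right_inv u (by omega) (by omega)
    have ru' := h.right_inv (u + 1) (by omega) (by omega)
    have hpu := h.ieven u (by omega) (by omega)
    have : p (u + 1) ≠ i + 1 := by intro e; rw [e] at ru'; omega
    rcases Int.emod_two_eq_zero_or_one u with hu | hu
    · have := h.baxter_even u i (by omega) (by omega) hu (by omega)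
      omega
    · have := h.baxter_odd u (i + 1) (by omega) (by omega) hu (by omega)
      omega
  · obtain ⟨u, hu1, hu2, hu3, hu4⟩ := exists_int_crossing (P := fun u => i < p u)
      hv2.le (by omega) (by omega)
    have ru := h.right_inv u (by omega) (by omega)
    have ru' := h.right_inv (u + 1) (by omega) (by omega)
    have hpu := h.ieven (u + 1) (by omega) (by omega)
    have : p u ≠ i + 1 := by intro e; rw [e] at ru; omega
    rcases Int.emod_two_eq_zero_or_one u with hu | hu
    · have := h.baxter_even u (i + 1) (by omega) (by omega) hu (by omega)
      omega
    · have := h.baxter_odd u i (by omega) (by omega) hu (by omega)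
      omega

theorem ibaxter_even (h : IsSnow k w p) (i v : ℤ) (h0 : 0 ≤ i) (h1 : i + 1 ≤ 4 * k)
    (hi : i % 2 = 0) (hv : w i < v ∧ v < w (i + 1) ∨ w (i + 1) < v ∧ v < w i) :
    i + 1 < p v := by
  have := h.rot.ibaxter_odd (4 * k - (i + 1)) (4 * k - v) (by omega) (by omega) (by omega)
  simp only [sub_sub_cancel] at this
  rw [show 4 * k - (4 * k - (i + 1) + 1) = i by ring] at this
  have := this (by omega)
  omega

theorem symm (h : IsSnow k w p) : IsSnow k p w where
  nonneg := h.nonneg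
  map := h.imap
  imap := h.map
  left_inv := h.right_inv
  right_inv := h.left_inv
  zero := by rw [← h.last]; exact h.left_inv _ (by have := h.nonneg; omega) le_rfl
  last := by rw [← h.zero]; exact h.left_inv _ le_rfl (by have := h.nonneg; omega)
  parity := h.ieven
  baxter_odd i v h0 h1 hi hv := h.ibaxter_odd i v h0 h1 hi hv
  baxter_even i v h0 h1 hi hv := h.ibaxter_even i v h0 h1 hi hv
  alt := h.ialt
  ialt := h.alt

/-! ### Local structure at positions divisible by 4 -/

/-- The local structure of `w` at an interior position divisible by `4`. -/
theorem descent (h : IsSnow k w p) {i : ℤ} (h0 : 0 < i) (h1 : i < 4 * k) (hi : i % 4 = 0) :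
    w i % 4 = 0 ∧ w (i + 1) < w i ∧ w i < w (i - 1) ∧
    (∀ u, w i < u → u ≤ w (i - 1) → p u ≤ i - 1) ∧
    (∀ u, w (i + 1) ≤ u → u < w i → i + 1 ≤ p u) := by
  have e : i - 1 + 1 = i := by ring
  have a := (h.alt (i - 1) (by omega) (by omega)).2 (by omega)
  rw [show i - 1 + 2 = i + 1 by ring] at a
  have par := h.parity i (by omega) (by omega)
  have par0 := h.parity (i - 1) (by omega) (by omega)
  have par1 := h.parity (i + 1) (by omega) (by omega)
  have m0 := h.map (i - 1) (by omega) (by omega)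
  have m1 := h.map (i + 1) (by omega) (by omega)
  have q0 := h.left_inv (i - 1) (by omega) (by omega)
  have q1 := h.left_inv (i + 1) (by omega) (by omega)
  have c1 : w (i + 1) < w i := by
    by_contra hc
    have := h.ibaxter_odd (i - 1) (w (i + 1)) (by omega) (by omega) (by omega)
      (by rw [e]; omega)
    omega
  have c2 : w i < w (i - 1) := by
    by_contra hc
    have := h.ibaxter_even i (w (i - 1)) (by omega) (by omega) (by omega) (by omega)
    omega
  have c3 : ∀ u, w i < u → u ≤ w (i - 1) → p u ≤ i - 1 := by
    intro u hu1 hu2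
    rcases hu2.eq_or_lt with rfl | hu2
    · omega
    · have := h.ibaxter_odd (i - 1) u (by omega) (by omega) (by omega) (by rw [e]; omega)
      omega
  have c4 : ∀ u, w (i + 1) ≤ u → u < w i → i + 1 ≤ p u := by
    intro u hu1 hu2
    rcases hu1.eq_or_lt with rfl | hu1
    · omega
    · have := h.ibaxter_even i u (by omega) (by omega) (by omega) (by omega)
      omega
  refine ⟨?_, c1, c2, c3, c4⟩
  have d1 := c3 (w i + 1) (by omega) (by omega)
  have d2 := c4 (w i - 1) (by omega) (by omega)
  -- Otherwise `w i - 1` is 1 mod 4 and inverse alternation puts `w i - 1` left of `w i + 1`,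
  -- contrary to `d1` and `d2`.
  by_contra hc
  have := (h.ialt (w i - 1) (by omega) (by omega)).1 (by omega)
  rw [show w i - 1 + 2 = w i + 1 by ring] at this
  omega

theorem emod_four (h : IsSnow k w p) {i : ℤ} (h0 : 0 ≤ i) (h1 : i ≤ 4 * k) (hi : i % 4 = 0) :
    w i % 4 = 0 := by
  rcases h0.eq_or_lt with rfl | h0
  · rw [h.zero]; omega
  rcases h1.eq_or_lt with rfl | h1
  · rw [h.last]; omega
  exact (h.descent h0 h1 hi).1

theorem emod_four_two (h : IsSnow k w p) {i : ℤ} (h0 : 0 ≤ i) (h1 : i ≤ 4 * k)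
    (hi : i % 4 = 2) : w i % 4 = 2 := by
  have m := h.map i h0 h1
  have e := h.parity i h0 h1
  by_contra hc
  have := h.symm.emod_four m.1 m.2 (by omega)
  rw [h.left_inv i h0 h1] at this
  omega

/-- Two adjacent descents facing each other must match: with `V = w i`, `X = w (i - 1)` and `J` the
position of `V + 1`, either `X = V + 1` or `X + 1` stands just left of `J`. A mismatch produces a
half-turned instance of the same configuration with a shorter distance between its two positions,
whence the induction on `n` for all `w` at once. -/
theorem above_aux (n : ℕ) : ∀ {w p : ℤ → ℤ}, IsSnow k w p →
    ∀ {i : ℤ}, 0 < i → i < 4 * k → i % 4 = 0 → i - p (w i + 1) < n →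
    w (i - 1) = w i + 1 ∨ w (p (w i + 1) - 1) = w (i - 1) + 1 := by
  induction n with
  | zero =>
    intro w p h i h0 h1 hi hn
    have d := h.descent h0 h1 hi
    have := d.2.2.2.1 (w i + 1) (by omega) (by omega)
    push_cast at hn
    omega
  | succ n ih =>
    intro w p h i h0 h1 hi hn
    -- The induction hypothesis for the half-turned permutation.
    have below : ∀ {j : ℤ}, 0 < j → j < 4 * k → j % 4 = 0 → p (w j - 1) - j < n →
        w (j + 1) = w j - 1 ∨ w (p (w j - 1) + 1) = w (j + 1) - 1 := by
      intro j j0 j1 hj hjn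
      have := ih h.rot (i := 4 * k - j) (by omega) (by omega) (by omega)
      simp only [sub_sub_cancel] at this
      rw [show 4 * k - (4 * k - w j + 1) = w j - 1 by ring,
        show 4 * k - (4 * k - j - 1) = j + 1 by ring,
        show 4 * k - (4 * k - p (w j - 1) - 1) = p (w j - 1) + 1 by ring] at this
      have := this (by omega)
      omega
    obtain ⟨dV, d1, d2, d3, d4⟩ := h.descent h0 h1 hi
    set V := w i with hV
    set X := w (i - 1) with hX
    by_cases hXV : X = V + 1
    · exact Or.inl hXV
    right
    have mX := h.map (i - 1) (by omega) (by omega)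
    have qX := h.left_inv (i - 1) (by omega) (by omega)
    have pX := h.parity (i - 1) (by omega) (by omega)
    have mW := h.map (i + 1) (by omega) (by omega)
    have qV := h.left_inv i (by omega) (by omega)
    rw [← hX] at mX qX pX
    -- If `X` were 1 mod 4, inverse alternation would place `X - 2` right of `X`, while `d3` keeps
    -- it left.
    have X4 : X % 4 = 3 := by
      by_contra hc
      have a := (h.ialt (X - 2) (by omega) (by omega)).2 (by omega)
      rw [sub_add_cancel] at a
      have := d3 (X - 2) (by omega) (by omega)
      omega
    set J := p (V + 1) with hJ
    have mJ := h.imap (V + 1) (by omega) (by omega)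
    have pJ := h.ieven (V + 1) (by omega) (by omega)
    have rJ := h.right_inv (V + 1) (by omega) (by omega)
    have J1 := d3 (V + 1) (by omega) (by omega)
    rw [← hJ] at mJ pJ rJ J1
    have J2 : J ≠ i - 1 := by intro e; rw [e] at rJ; omega
    -- If `J` were 3 mod 4, the entry at `J + 2` would be below `V + 1`, but it lies between `V + 1`
    -- and `V`, where all entries are larger.
    have J4 : J % 4 = 1 := by
      by_contra hc
      have a := (h.alt J (by omega) (by omega)).2 (by omega)
      have := h.baxter_even V (J + 2) (by omega) (by omega) (by omega)
        (Or.inr ⟨by omega, by rw [hV, qV]; omega⟩)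
      omega
    set Y := w (J - 1) with hY
    have mY := h.map (J - 1) (by omega) (by omega)
    have qY := h.left_inv (J - 1) (by omega) (by omega)
    have Y4 := h.emod_four (i := J - 1) (by omega) (by omega) (by omega)
    rw [← hY] at mY qY Y4
    -- The aim is `Y = X + 1`. If `Y` is larger, `below` applies at the position of `X + 1`; if
    -- smaller, at `J - 1`.
    rcases lt_trichotomy (X + 1) Y with hXY | hXY | hXY
    · set H := p (X + 1) with hH
      have mH := h.imap (X + 1) (by omega) (by omega)
      have rH := h.right_inv (X + 1) (by omega) (by omega)
      have H4 := h.symm.emod_four (i := X + 1) (by omega) (by omega) (by omega)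
      rw [← hH] at mH rH H4
      have H0 : H ≠ 0 := by intro e; rw [e, h.zero] at rH; omega
      have HM : H ≠ 4 * k := by intro e; rw [e, h.last] at rH; omega
      have HJ : J ≤ H := by
        by_cases J0 : J = 1
        · omega
        · have := (h.descent (i := J - 1) (by omega) (by omega) (by omega)).2.2.2.2 (X + 1)
            (by rw [sub_add_cancel, rJ]; omega) (by omega)
          omega
      have := below (j := H) (by omega) (by omega) H4
        (by rw [rH, add_sub_cancel_right, qX]; push_cast at hn; omega)
      rw [rH, add_sub_cancel_right, qX, sub_add_cancel, ← hV] at this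
      rcases this with this | this
      · have q := h.left_inv (H + 1) (by omega) (by omega)
        rw [this, qX] at q
        omega
      · have q := h.left_inv (H + 1) (by omega) (by omega)
        rw [show w (H + 1) = V + 1 by omega, ← hJ] at q
        rw [hY, q, add_sub_cancel_right, rH]
    · exact hXY.symm
    · have J0 : J ≠ 1 := by
        intro e
        rw [e, sub_self, h.zero] at hY
        omega
      have dJ := h.descent (i := J - 1) (by omega) (by omega) (by omega)
      rw [sub_add_cancel, rJ, ← hY] at dJ
      have b1 := d3 (Y - 1) (by omega) (by omega)
      have b2 : p (Y - 1) ≠ i - 1 := by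
        intro e
        have r := h.right_inv (Y - 1) (by omega) (by omega)
        rw [e] at r
        omega
      have := below (j := J - 1) (by omega) (by omega) (by omega)
        (by rw [← hY]; push_cast at hn; omega)
      rw [sub_add_cancel, rJ, ← hY] at this
      rcases this with this | this
      · omega
      · have m := h.imap (Y - 1) (by omega) (by omega)
        have q := h.left_inv (p (Y - 1) + 1) (by omega) (by omega)
        rw [this, add_sub_cancel_right, hV, qV] at q
        omega

theorem above (h : IsSnow k w p) {i : ℤ} (h0 : 0 < i) (h1 : i < 4 * k) (hi : i % 4 = 0) :
    w (i - 1) = w i + 1 ∨ w (p (w i + 1) - 1) = w (i - 1) + 1 :=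
  above_aux ((i - p (w i + 1)).toNat + 1) h h0 h1 hi (by push_cast; omega)

/-! ### Splitting a framed permutation -/

/-- The first entry `w 1` either is minimal or starts a skew block. -/
theorem corner (h : IsSnow k w p) (hk : 0 < k) : ∃ i v, 0 < i ∧ i % 4 = 0 ∧ i + v = 4 * k ∧
    0 ≤ v ∧ w 1 = v + 1 ∧ w i = v ∧ (v = 0 ∨ w (i - 1) = 4 * k - 1) ∧
    (∀ j, 0 ≤ j → j ≤ i → v ≤ w j) ∧ (∀ u, v ≤ u → u ≤ 4 * k → p u ≤ i) := by
  have m1 := h.map 1 (by omega) (by omega)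
  have e1 := h.parity 1 (by omega) (by omega)
  have q1 := h.left_inv 1 (by omega) (by omega)
  have C4 : w 1 % 4 = 1 := by
    by_contra hc
    have a := (h.ialt (w 1 - 2) (by omega) (by omega)).1 (by omega)
    rw [sub_add_cancel, q1] at a
    have := h.ieven (w 1 - 2) (by omega) (by omega)
    have := h.imap (w 1 - 2) (by omega) (by omega)
    omega
  obtain ⟨v, hv⟩ : ∃ v, w 1 = v + 1 := ⟨w 1 - 1, by ring⟩
  rw [hv] at m1 e1 q1 C4
  have rI := h.right_inv v (by omega) (by omega)
  have mI := h.imap v (by omega) (by omega)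
  have I4 := h.symm.emod_four (i := v) (by omega) (by omega) (by omega)
  have hle : ∀ j, 0 ≤ j → j ≤ p v → v ≤ w j := by
    intro j j0 j1
    rcases eq_or_ne j 0 with rfl | j2
    · rw [h.zero]; omega
    rcases eq_or_ne j 1 with rfl | j3
    · omega
    rcases eq_or_ne j (p v) with rfl | j4
    · omega
    have := h.baxter_even v j (by omega) (by omega) (by omega) (by omega)
    omega
  have p0 : p v ≠ 0 := by intro e; rw [e, h.zero] at rI; omega
  -- Here `v + 1` stands at position 1, so `above` compares `w (p v - 1) + 1` with the frame entry
  -- `w 0 = 4k`.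
  have top : v = 0 ∨ w (p v - 1) = 4 * k - 1 := by
    by_cases v0 : v = 0
    · exact Or.inl v0
    right
    have pM : p v ≠ 4 * k := by intro e; rw [e, h.last] at rI; omega
    have := h.above (i := p v) (by omega) (by omega) I4
    rw [rI, q1, sub_self, h.zero] at this
    rcases this with this | this
    · have q := h.left_inv (p v - 1) (by omega) (by omega)
      rw [this, q1] at q
      omega
    · omega
  -- The descent from `4k - 1` to `v` forces all values in between to the left; for `v = 0` the
  -- position is already the last one.
  have hpe : ∀ u, v ≤ u → u ≤ 4 * k → p u ≤ p v := by
    intro u u0 u1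
    rcases eq_or_ne u v with rfl | hu
    · exact le_rfl
    rcases top with v0 | top
    · have := h.imap u (by omega) u1
      have : p 0 = 4 * k := by rw [← h.last]; exact h.left_inv _ (by omega) le_rfl
      rw [v0, this]; omega
    rcases eq_or_ne u (4 * k) with rfl | u2
    · have : p (4 * k) = 0 := by rw [← h.zero]; exact h.left_inv _ le_rfl (by omega)
      omega
    · by_cases v0 : v = 0
      · have := h.imap u (by omega) u1
        have : p 0 = 4 * k := by rw [← h.last]; exact h.left_inv _ (by omega) le_rfl
        rw [v0, this]; omega
      have pM : p v ≠ 4 * k := by intro e; rw [e, h.last] at rI; omega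
      have := (h.descent (i := p v) (by omega) (by omega) I4).2.2.2.1 u (by omega) (by omega)
      omega
  refine ⟨p v, v, by omega, I4, ?_, by omega, hv, rI, top, hle, hpe⟩
  -- By `hle` and `hpe`, `w` maps `[0, p v]` onto `[v, 4k]`; comparing sizes gives `p v + v = 4k`.
  have hc : (Finset.Icc 0 (p v)).card = (Finset.Icc v (4 * k)).card := by
    refine Finset.card_nbij' w p ?_ ?_ ?_ ?_
    · intro j hj
      simp only [Finset.coe_Icc, Set.mem_Icc] at hj ⊢
      exact ⟨hle j hj.1 hj.2, (h.map j hj.1 (by omega)).2⟩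
    · intro u hu
      simp only [Finset.coe_Icc, Set.mem_Icc] at hu ⊢
      exact ⟨(h.imap u (by omega) hu.2).1, hpe u hu.1 hu.2⟩
    · intro j hj
      simp only [Finset.coe_Icc, Set.mem_Icc] at hj
      exact h.left_inv j hj.1 (by omega)
    · intro u hu
      simp only [Finset.coe_Icc, Set.mem_Icc] at hu
      exact h.right_inv u (by omega) hu.2
  simp only [Int.card_Icc] at hc
  omega

/-- Settles the case `v = 0` left open by `corner`: in the half-turned permutation, a proper skew
block would put the value 1 at a position other than 1. -/
theorem last_of_first (h : IsSnow k w p) (hk : 0 < k) (h1 : w 1 = 1) :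
    w (4 * k - 1) = 4 * k - 1 := by
  obtain ⟨i, v, hi0, hi4, hiv, hv0, hf, hi, ht, -, -⟩ := h.rot.corner hk
  rcases ht with ht | ht
  · omega
  · rw [show 4 * k - (i - 1) = 4 * k - i + 1 by ring] at ht
    by_cases hc : i = 4 * k
    · omega
    have q1 := h.left_inv 1 (by omega) (by omega)
    have q := h.left_inv (4 * k - i + 1) (by omega) (by omega)
    rw [show w (4 * k - i + 1) = 1 by omega, ← h1, q1] at q
    omega

theorem decomp (h : IsSnow k w p) (hk : 0 < k) : ∃ k₁ k₂ w₁ p₁ w₂ p₂,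
    IsSnow k₁ w₁ p₁ ∧ IsSnow k₂ w₂ p₂ ∧ k = k₁ + 1 + k₂ ∧
    (∀ i, 0 ≤ i → i ≤ 4 * k₁ → w (i + 2) = 4 * k - 2 - w₁ i) ∧
    (∀ i, 0 ≤ i → i ≤ 4 * k₂ → w (4 * k₁ + 4 + i) = w₂ i) := by
  obtain ⟨I, v, hI0, hI4, hIv, hv0, hf, hI, ht, hle, hpe⟩ := h.corner hk
  have ht : w (I - 1) = 4 * k - 1 := by
    rcases ht with rfl | ht
    · have := h.last_of_first hk hf
      rw [← this]; congr 1; omega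
    · exact ht
  obtain ⟨k₁, hk₁⟩ : ∃ k₁, I = 4 * k₁ + 4 := ⟨(I - 4) / 4, by omega⟩
  obtain ⟨k₂, hk₂⟩ : ∃ k₂, v = 4 * k₂ := ⟨v / 4, by omega⟩
  have hz := h.zero
  have pz : p (4 * k) = 0 := by rw [← hz]; exact h.left_inv _ le_rfl (by omega)
  have pI : p v = I := by rw [← hI]; exact h.left_inv _ (by omega) (by omega)
  have p1 : p (v + 1) = 1 := by rw [← hf]; exact h.left_inv _ (by omega) (by omega)
  have pt : p (4 * k - 1) = I - 1 := by rw [← ht]; exact h.left_inv _ (by omega) (by omega)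
  -- If `w 2` were larger, `v + 2` would lie between `w 1` and `w 2`, so its position would be 0,
  -- which is taken by `4k`.
  have w2 : w 2 = v + 2 := by
    have m := h.map 2 (by omega) (by omega)
    have q := h.left_inv 2 (by omega) (by omega)
    have e := h.parity 2 (by omega) (by omega)
    have := hle 2 (by omega) (by omega)
    have hne : w 2 ≠ v := by intro e; rw [e, pI] at q; omega
    have hne' : w 2 ≠ 4 * k := by intro e; rw [e, pz] at q; omega
    by_contra hc
    have := h.ibaxter_odd 1 (v + 2) (by omega) (by omega) (by omega)
      (by rw [show (1 : ℤ) + 1 = 2 by rfl]; omega)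
    have m' := h.imap (v + 2) (by omega) (by omega)
    have r := h.right_inv (v + 2) (by omega) (by omega)
    rw [show p (v + 2) = 0 by omega] at r
    omega
  have w3 : w (I - 2) = 4 * k - 2 := by
    have m := h.map (I - 2) (by omega) (by omega)
    have q := h.left_inv (I - 2) (by omega) (by omega)
    have e := h.parity (I - 2) (by omega) (by omega)
    have := hle (I - 2) (by omega) (by omega)
    have hne : w (I - 2) ≠ v := by intro e; rw [e, pI] at q; omega
    have hne' : w (I - 2) ≠ 4 * k := by intro e; rw [e, pz] at q; omega
    by_contra hc
    have := h.ibaxter_even (I - 2) (4 * k - 2) (by omega) (by omega) (by omega)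
      (by rw [show I - 2 + 1 = I - 1 by ring]; omega)
    have := hpe (4 * k - 2) (by omega) (by omega)
    have r := h.right_inv (4 * k - 2) (by omega) (by omega)
    rw [show p (4 * k - 2) = I by omega] at r
    omega
  have winI : ∀ j, 2 ≤ j → j ≤ I - 2 → v + 2 ≤ w j ∧ w j ≤ 4 * k - 2 := by
    intro j j0 j1
    have m := h.map j (by omega) (by omega)
    have q := h.left_inv j (by omega) (by omega)
    have := hle j (by omega) (by omega)
    have n1 : w j ≠ v := by intro e; rw [e] at q; omega
    have n2 : w j ≠ v + 1 := by intro e; rw [e] at q; omega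
    have n3 : w j ≠ 4 * k := by intro e; rw [e] at q; omega
    have n4 : w j ≠ 4 * k - 1 := by intro e; rw [e] at q; omega
    omega
  have pinI : ∀ u, v + 2 ≤ u → u ≤ 4 * k - 2 → 2 ≤ p u ∧ p u ≤ I - 2 := by
    intro u u0 u1
    have m := h.imap u (by omega) (by omega)
    have q := h.right_inv u (by omega) (by omega)
    have := hpe u (by omega) (by omega)
    have n1 : p u ≠ 0 := by intro e; rw [e] at q; omega
    have n2 : p u ≠ 1 := by intro e; rw [e] at q; omega
    have n3 : p u ≠ I := by intro e; rw [e] at q; omega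
    have n4 : p u ≠ I - 1 := by intro e; rw [e] at q; omega
    omega
  have wout : ∀ j, I ≤ j → j ≤ 4 * k → 0 ≤ w j ∧ w j ≤ v := by
    intro j j0 j1
    have m := h.map j (by omega) (by omega)
    have q := h.left_inv j (by omega) (by omega)
    by_contra hc
    have := hpe (w j) (by omega) (by omega)
    rw [show j = I by omega] at hc
    omega
  have pout : ∀ u, 0 ≤ u → u ≤ v → I ≤ p u ∧ p u ≤ 4 * k := by
    intro u u0 u1
    have m := h.imap u (by omega) (by omega)
    have q := h.right_inv u (by omega) (by omega)
    by_contra hc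
    have := hle (p u) (by omega) (by omega)
    rw [show u = v by omega] at hc
    omega
  -- The middle block occupies positions `[2, I - 2]` and values `[v + 2, 4k - 2]`, with minimum
  -- first and maximum last by `w2` and `w3`; complementing it yields the required frame.
  refine ⟨k₁, k₂, fun i => 4 * k - 2 - w (i + 2), fun u => p (4 * k - 2 - u) - 2,
    fun i => w (I + i), fun u => p u - I, ?_, ?_, by omega, ?_, ?_⟩
  · constructor
    · omega
    · intro i h0 h1; have := winI (i + 2) (by omega) (by omega); omega
    · intro i h0 h1; have := pinI (4 * k - 2 - i) (by omega) (by omega); omega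
    · intro i h0 h1
      have := h.left_inv (i + 2) (by omega) (by omega); simp only [sub_sub_cancel]; omega
    · intro i h0 h1
      have := h.right_inv (4 * k - 2 - i) (by omega) (by omega)
      simp only [sub_add_cancel]; omega
    · rw [zero_add, w2]; omega
    · rw [show 4 * k₁ + 2 = I - 2 by omega, w3]; omega
    · intro i h0 h1; have := h.parity (i + 2) (by omega) (by omega); omega
    · intro u i h0 h1 hu hb
      have := h.baxter_even (4 * k - 2 - (u + 1)) (i + 2) (by omega) (by omega) (by omega)
      rw [show 4 * k - 2 - (u + 1) + 1 = 4 * k - 2 - u by ring] at this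
      have := this (by omega)
      omega
    · intro u i h0 h1 hu hb
      have := h.baxter_odd (4 * k - 2 - (u + 1)) (i + 2) (by omega) (by omega) (by omega)
      rw [show 4 * k - 2 - (u + 1) + 1 = 4 * k - 2 - u by ring] at this
      have := this (by omega)
      omega
    · intro i h0 h1
      have := h.alt (i + 2) (by omega) (by omega)
      constructor <;> intro h2
      · have := this.2 (by omega); omega
      · have := this.1 (by omega); omega
    · intro i h0 h1
      have := h.ialt (4 * k - 2 - (i + 2)) (by omega) (by omega)
      rw [show 4 * k - 2 - (i + 2) + 2 = 4 * k - 2 - i by ring] at this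
      constructor <;> intro h2
      · have := this.2 (by omega); omega
      · have := this.1 (by omega); omega
  · constructor
    · omega
    · intro i h0 h1; have := wout (I + i) (by omega) (by omega); omega
    · intro i h0 h1; have := pout i (by omega) (by omega); omega
    · intro i h0 h1
      have := h.left_inv (I + i) (by omega) (by omega); omega
    · intro i h0 h1
      have := h.right_inv i (by omega) (by omega)
      simp only [add_sub_cancel]; omega
    · rw [add_zero]; omega
    · rw [show I + 4 * k₂ = 4 * k by omega, h.last]
    · intro i h0 h1; have := h.parity (I + i) (by omega) (by omega); omega
    · intro u i h0 h1 hu hb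
      exact h.baxter_odd u (I + i) (by omega) (by omega) hu (by omega)
    · intro u i h0 h1 hu hb
      exact h.baxter_even u (I + i) (by omega) (by omega) hu (by omega)
    · intro i h0 h1
      have := h.alt (I + i) (by omega) (by omega)
      rw [add_assoc] at this
      constructor <;> intro h2
      · exact this.1 (by omega)
      · exact this.2 (by omega)
    · intro i h0 h1
      have := h.ialt i (by omega) (by omega)
      constructor <;> intro h2
      · have := this.1 (by omega); omega
      · have := this.2 (by omega); omega
  · intro i h0 h1; ring
  · intro i h0 h1; rw [hk₁]

/-! ### Gluing two framed permutations -/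

/-- Converse of `decomp`: the word is `4k`, `4k₂ + 1`, the complement of `w₁`, `4k - 1`, `w₂`.
Inside the blocks every condition is inherited; only the seams need an argument, through `wtop` and
`wbot` for the Baxter conditions. -/
theorem exists_glue {k₁ k₂ : ℤ} {w₁ p₁ w₂ p₂ : ℤ → ℤ} (h₁ : IsSnow k₁ w₁ p₁)
    (h₂ : IsSnow k₂ w₂ p₂) : ∃ w p, IsSnow (k₁ + 1 + k₂) w p ∧
    (∀ i, 0 ≤ i → i ≤ 4 * k₁ → w (i + 2) = 4 * (k₁ + 1 + k₂) - 2 - w₁ i) ∧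
    (∀ i, 0 ≤ i → i ≤ 4 * k₂ → w (4 * k₁ + 4 + i) = w₂ i) := by
  have n₁ := h₁.nonneg
  have n₂ := h₂.nonneg
  obtain ⟨k, hk⟩ : ∃ k, k = k₁ + 1 + k₂ := ⟨_, rfl⟩
  obtain ⟨w, w0, w1, wi, wt, wo⟩ : ∃ w : ℤ → ℤ, w 0 = 4 * k ∧ w 1 = 4 * k₂ + 1 ∧
      (∀ i, 0 ≤ i → i ≤ 4 * k₁ → w (i + 2) = 4 * k - 2 - w₁ i) ∧ w (4 * k₁ + 3) = 4 * k - 1 ∧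
      (∀ i, 0 ≤ i → w (4 * k₁ + 4 + i) = w₂ i) := by
    refine ⟨fun i => if i = 0 then 4 * k else if i = 1 then 4 * k₂ + 1 else
      if i ≤ 4 * k₁ + 2 then 4 * k - 2 - w₁ (i - 2) else if i = 4 * k₁ + 3 then 4 * k - 1 else
      w₂ (i - (4 * k₁ + 4)), by simp, by simp, ?_, ?_, ?_⟩
    · intro i a b
      simp only
      rw [if_neg (by omega), if_neg (by omega), if_pos (by omega), add_sub_cancel_right]
    · simp only
      rw [if_neg (by omega), if_neg (by omega), if_neg (by omega), if_pos trivial]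
    · intro i a
      simp only
      rw [if_neg (by omega), if_neg (by omega), if_neg (by omega), if_neg (by omega),
        add_sub_cancel_left]
  obtain ⟨p, pt, pt', pin, p1, po⟩ : ∃ p : ℤ → ℤ, p (4 * k) = 0 ∧ p (4 * k - 1) = 4 * k₁ + 3 ∧
      (∀ u, 0 ≤ u → u ≤ 4 * k₁ → p (4 * k - 2 - u) = 2 + p₁ u) ∧ p (4 * k₂ + 1) = 1 ∧
      (∀ u, u ≤ 4 * k₂ → p u = 4 * k₁ + 4 + p₂ u) := by
    refine ⟨fun u => if u = 4 * k then 0 else if u = 4 * k - 1 then 4 * k₁ + 3 else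
      if 4 * k₂ + 2 ≤ u then 2 + p₁ (4 * k - 2 - u) else if u = 4 * k₂ + 1 then 1 else
      4 * k₁ + 4 + p₂ u, by simp, by simp, ?_, ?_, ?_⟩
    · intro i a b
      simp only
      rw [if_neg (by omega), if_neg (by omega), if_pos (by omega), sub_sub_cancel]
    · simp only
      rw [if_neg (by omega), if_neg (by omega), if_neg (by omega), if_pos trivial]
    · intro i a
      simp only
      rw [if_neg (by omega), if_neg (by omega), if_neg (by omega), if_neg (by omega)]
  have wcase : ∀ i, 0 ≤ i → i ≤ 4 * k → i = 0 ∨ i = 1 ∨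
      (∃ j, i = j + 2 ∧ 0 ≤ j ∧ j ≤ 4 * k₁) ∨ i = 4 * k₁ + 3 ∨
      ∃ j, i = 4 * k₁ + 4 + j ∧ 0 ≤ j ∧ j ≤ 4 * k₂ := by
    intro i a b
    by_cases c : i ≤ 4 * k₁ + 2
    · by_cases c2 : 2 ≤ i
      · exact Or.inr (Or.inr (Or.inl ⟨i - 2, by omega, by omega, by omega⟩))
      · omega
    · by_cases c2 : i = 4 * k₁ + 3
      · omega
      · exact Or.inr (Or.inr (Or.inr (Or.inr ⟨i - (4 * k₁ + 4), by omega, by omega, by omega⟩)))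
  have pcase : ∀ u, 0 ≤ u → u ≤ 4 * k → u = 4 * k ∨ u = 4 * k - 1 ∨
      (∃ j, u = 4 * k - 2 - j ∧ 0 ≤ j ∧ j ≤ 4 * k₁) ∨ u = 4 * k₂ + 1 ∨ u ≤ 4 * k₂ := by
    intro u a b
    by_cases c : 4 * k₂ + 2 ≤ u
    · by_cases c2 : u ≤ 4 * k - 2
      · exact Or.inr (Or.inr (Or.inl ⟨4 * k - 2 - u, by omega, by omega, by omega⟩))
      · omega
    · omega
  have p₁z : p₁ 0 = 4 * k₁ := h₁.symm.zero
  have p₁l : p₁ (4 * k₁) = 0 := h₁.symm.last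
  have p₂z : p₂ 0 = 4 * k₂ := h₂.symm.zero
  have p₂l : p₂ (4 * k₂) = 0 := h₂.symm.last
  have w₁z := h₁.zero
  have w₁l := h₁.last
  have w₂z := h₂.zero
  have w₂l := h₂.last
  have map : ∀ i, 0 ≤ i → i ≤ 4 * k → 0 ≤ w i ∧ w i ≤ 4 * k := by
    intro i a b
    rcases wcase i a b with rfl | rfl | ⟨j, rfl, c, d⟩ | rfl | ⟨j, rfl, c, d⟩
    · omega
    · omega
    · have := h₁.map j c d; rw [wi j c d]; omega
    · omega
    · have := h₂.map j c d; rw [wo j c]; omega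
  have wtop : ∀ i, 0 < i → i < 4 * k₁ + 3 → w i < 4 * k - 1 := by
    intro i a b
    rcases wcase i (by omega) (by omega) with rfl | rfl | ⟨j, rfl, c, d⟩ | rfl | ⟨j, rfl, c, d⟩
    · omega
    · omega
    · have := h₁.map j c d; rw [wi j c d]; omega
    · omega
    · omega
  have wbot : ∀ i, 1 < i → i < 4 * k₁ + 4 → 4 * k₂ + 1 < w i := by
    intro i a b
    rcases wcase i (by omega) (by omega) with rfl | rfl | ⟨j, rfl, c, d⟩ | rfl | ⟨j, rfl, c, d⟩
    · omega
    · omega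
    · have := h₁.map j c d; rw [wi j c d]; omega
    · omega
    · omega
  refine ⟨w, p, ?_, hk ▸ wi, fun i a _ => wo i a⟩
  rw [← hk]
  constructor
  · omega
  · exact map
  · intro u a b
    rcases pcase u a b with rfl | rfl | ⟨j, rfl, c, d⟩ | rfl | c
    · omega
    · omega
    · have := h₁.imap j c d; rw [pin j c d]; omega
    · omega
    · have := h₂.imap u a c; rw [po u c]; omega
  · intro i a b
    rcases wcase i a b with rfl | rfl | ⟨j, rfl, c, d⟩ | rfl | ⟨j, rfl, c, d⟩
    · rw [w0, pt]
    · rw [w1, p1]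
    · have m := h₁.map j c d
      rw [wi j c d, pin _ m.1 m.2, h₁.left_inv j c d, add_comm]
    · rw [wt, pt']
    · have m := h₂.map j c d
      rw [wo j c, po _ m.2, h₂.left_inv j c d]
  · intro u a b
    rcases pcase u a b with rfl | rfl | ⟨j, rfl, c, d⟩ | rfl | c
    · rw [pt, w0]
    · rw [pt', wt]
    · have m := h₁.imap j c d
      rw [pin j c d, add_comm, wi _ m.1 m.2, h₁.right_inv j c d]
    · rw [p1, w1]
    · have m := h₂.imap u a c
      rw [po u c, wo _ m.1, h₂.right_inv u a c]
  · exact w0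
  · rw [show 4 * k = 4 * k₁ + 4 + 4 * k₂ by omega, wo _ (by omega), w₂l]
  · intro i a b
    rcases wcase i a b with rfl | rfl | ⟨j, rfl, c, d⟩ | rfl | ⟨j, rfl, c, d⟩
    · omega
    · omega
    · have := h₁.parity j c d; rw [wi j c d]; omega
    · omega
    · have := h₂.parity j c d; rw [wo j c]; omega
  · intro v i a b hv hb
    rcases pcase v a (by omega) with rfl | rfl | ⟨j, rfl, c, d⟩ | rfl | c
    · omega
    · rw [pt', sub_add_cancel, pt] at hb
      exact wtop i (by omega) (by omega)
    · rw [show 4 * k - 2 - j + 1 = 4 * k - 2 - (j - 1) by ring, pin j c d,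
        pin (j - 1) (by omega) (by omega)] at hb
      have m := h₁.imap j c d
      have m' := h₁.imap (j - 1) (by omega) (by omega)
      have := h₁.baxter_even (j - 1) (i - 2) (by omega) (by omega) (by omega)
        (by rw [sub_add_cancel]; omega)
      rw [show i = i - 2 + 2 by ring, wi (i - 2) (by omega) (by omega)]
      omega
    · rw [p1, show 4 * k₂ + 1 + 1 = 4 * k - 2 - 4 * k₁ by omega, pin _ (by omega) le_rfl,
        p₁l] at hb
      omega
    · have m := h₂.imap v a c
      have m' := h₂.imap (v + 1) (by omega) (by omega)
      rw [po v c, po (v + 1) (by omega)] at hb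
      have := h₂.baxter_odd v (i - (4 * k₁ + 4)) (by omega) (by omega) (by omega) (by omega)
      rw [show i = 4 * k₁ + 4 + (i - (4 * k₁ + 4)) by ring, wo _ (by omega)]
      omega
  · intro v i a b hv hb
    rcases pcase v a (by omega) with rfl | rfl | ⟨j, rfl, c, d⟩ | rfl | c
    · omega
    · omega
    · rcases eq_or_ne j 0 with rfl | hj
      · rw [show 4 * k - 2 - 0 + 1 = 4 * k - 1 by ring, pin 0 c d, pt', p₁z] at hb
        omega
      rw [show 4 * k - 2 - j + 1 = 4 * k - 2 - (j - 1) by ring, pin j c d,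
        pin (j - 1) (by omega) (by omega)] at hb
      have m := h₁.imap j c d
      have m' := h₁.imap (j - 1) (by omega) (by omega)
      have := h₁.baxter_odd (j - 1) (i - 2) (by omega) (by omega) (by omega)
        (by rw [sub_add_cancel]; omega)
      rw [show i = i - 2 + 2 by ring, wi (i - 2) (by omega) (by omega)]
      omega
    · omega
    · rcases c.eq_or_lt with rfl | c
      · rw [po _ le_rfl, p1, p₂l] at hb
        exact wbot i (by omega) (by omega)
      have m := h₂.imap v a (by omega)
      have m' := h₂.imap (v + 1) (by omega) (by omega)
      rw [po v (by omega), po (v + 1) (by omega)] at hb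
      have := h₂.baxter_even v (i - (4 * k₁ + 4)) (by omega) (by omega) (by omega) (by omega)
      rw [show i = 4 * k₁ + 4 + (i - (4 * k₁ + 4)) by ring, wo _ (by omega)]
      omega
  · intro i a b
    rcases wcase i a (by omega) with rfl | rfl | ⟨j, rfl, c, d⟩ | rfl | ⟨j, rfl, c, d⟩
    · omega
    · refine ⟨fun _ => ?_, by omega⟩
      rw [w1]
      exact wbot _ (by omega) (by omega)
    · rcases lt_trichotomy (j + 1) (4 * k₁) with e | e | e
      · have := h₁.alt j c (by omega)
        rw [wi j c d, wi (j + 2) (by omega) (by omega)]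
        omega
      · refine ⟨fun _ => ?_, by omega⟩
        rw [show j + 2 + 2 = 4 * k₁ + 3 by omega, wt]
        exact wtop _ (by omega) (by omega)
      · omega
    · refine ⟨by omega, fun _ => ?_⟩
      have m := h₂.map 1 (by omega) (by omega)
      rw [show 4 * k₁ + 3 + 2 = 4 * k₁ + 4 + 1 by ring, wt, wo 1 (by omega)]
      omega
    · have := h₂.alt j c (by omega)
      rw [add_assoc (4 * k₁ + 4) j 2, wo j c, wo (j + 2) (by omega)]
      omega
  · intro v a b
    rcases pcase v a (by omega) with rfl | rfl | ⟨j, rfl, c, d⟩ | rfl | c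
    · omega
    · omega
    · rcases lt_trichotomy j 1 with e | e | e
      · omega
      · refine ⟨fun _ => ?_, by omega⟩
        have m := h₁.imap j c d
        rw [pin j c d, show 4 * k - 2 - j + 2 = 4 * k - 1 by omega, pt']
        have := h₁.right_inv 1 (by omega) (by omega)
        have : p₁ 1 ≠ 4 * k₁ := by intro e; rw [e, w₁l] at this; omega
        subst e
        omega
      · have := h₁.ialt (j - 2) (by omega) (by omega)
        rw [sub_add_cancel] at this
        rw [pin j c d, show 4 * k - 2 - j + 2 = 4 * k - 2 - (j - 2) by ring,
          pin (j - 2) (by omega) (by omega)]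
        omega
    · refine ⟨fun _ => ?_, by omega⟩
      rw [p1]
      rcases eq_or_ne k₁ 0 with e | e
      · rw [show 4 * k₂ + 1 + 2 = 4 * k - 1 by omega, pt']
        omega
      · have m := h₁.imap (4 * k₁ - 1) (by omega) (by omega)
        rw [show 4 * k₂ + 1 + 2 = 4 * k - 2 - (4 * k₁ - 1) by omega,
          pin _ (by omega) (by omega)]
        omega
    · rcases lt_trichotomy (v + 1) (4 * k₂) with e | e | e
      · have := h₂.ialt v a (by omega)
        rw [po v c, po (v + 2) (by omega)]
        omega
      · refine ⟨by omega, fun _ => ?_⟩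
        have m := h₂.imap v a (by omega)
        rw [show v + 2 = 4 * k₂ + 1 by omega, p1, po v c]
        omega
      · omega

end IsSnow

/-! ### Recursive generation of the pairs of threads -/

/-- Skew sum in one-line notation. -/
def lskew (a b : List ℤ) : List ℤ := a.map (· + (b.length : ℤ)) ++ b

/-- Complement in one-line notation. -/
def lcompl (a : List ℤ) : List ℤ := a.map ((a.length : ℤ) - 1 - ·)

/-- The pairs `(β, 1 ⊖ α ⊖ 1)` for the entangled even threads `α` and odd threads `β`, together
with the pair `([], [0])`. -/
inductive Threads : List ℤ → List ℤ → Prop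
  | nil : Threads [] [0]
  | node {β₁ α₁ β₂ α₂ : List ℤ} : Threads β₁ α₁ → Threads β₂ α₂ →
      Threads (lskew (lcompl α₁) β₂) (lskew [0] (lskew (lcompl β₁) α₂))

/-- The values read here are 2 mod 4, so the floor division standardizes them to `0, …, k - 1`. -/
def oddList (k : ℕ) (w : ℤ → ℤ) : List ℤ := (List.range k).map fun j : ℕ => w (4 * j + 2) / 4

/-- Both frame entries are included, hence `k + 1` entries. -/
def evenList (k : ℕ) (w : ℤ → ℤ) : List ℤ := (List.range (k + 1)).map fun j : ℕ => w (4 * j) / 4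

@[simp] theorem length_oddList (k : ℕ) (w : ℤ → ℤ) : (oddList k w).length = k := by
  simp [oddList]

@[simp] theorem length_evenList (k : ℕ) (w : ℤ → ℤ) : (evenList k w).length = k + 1 := by
  simp [evenList]

@[simp] theorem length_lskew (a b : List ℤ) : (lskew a b).length = a.length + b.length := by
  simp [lskew]

@[simp] theorem length_lcompl (a : List ℤ) : (lcompl a).length = a.length := by
  simp [lcompl]

@[simp] theorem lcompl_lcompl (a : List ℤ) : lcompl (lcompl a) = a := by
  simp [lcompl]

theorem lcompl_injective : Function.Injective lcompl :=
  Function.LeftInverse.injective lcompl_lcompl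

theorem Threads.length {β α : List ℤ} (h : Threads β α) : α.length = β.length + 1 := by
  induction h with
  | nil => rfl
  | node _ _ h₁ h₂ => simp; omega

section Glue

variable {k k₁ k₂ : ℕ} {w w₁ p₁ w₂ p₂ : ℤ → ℤ}

/-- The first block is shifted by 2 and complemented, so the odd thread of `w` picks up the
multiples of 4 of `w₁`. -/
theorem oddList_glue (h₁ : IsSnow k₁ w₁ p₁) (hk : k = k₁ + 1 + k₂)
    (e₁ : ∀ i : ℤ, 0 ≤ i → i ≤ 4 * k₁ → w (i + 2) = 4 * k - 2 - w₁ i)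
    (e₂ : ∀ i : ℤ, 0 ≤ i → i ≤ 4 * k₂ → w (4 * k₁ + 4 + i) = w₂ i) :
    oddList k w = lskew (lcompl (evenList k₁ w₁)) (oddList k₂ w₂) := by
  rw [oddList, hk, List.range_add, List.map_append, lskew]
  congr 1
  · rw [length_oddList, lcompl, length_evenList, evenList, List.map_map, List.map_map]
    refine List.map_congr_left fun j hj => ?_
    rw [List.mem_range] at hj
    have := h₁.emod_four (i := 4 * j) (by omega) (by omega) (by omega)
    rw [e₁ _ (by omega) (by omega)]
    simp only [Function.comp_apply]
    omega
  · rw [oddList, List.map_map]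
    refine List.map_congr_left fun j hj => ?_
    rw [List.mem_range] at hj
    rw [← e₂ _ (by omega) (by omega)]
    simp only [Function.comp_apply]
    congr 2
    push_cast
    ring

theorem evenList_glue (h₁ : IsSnow k₁ w₁ p₁) (hk : k = k₁ + 1 + k₂) (e₀ : w 0 = 4 * k)
    (e₁ : ∀ i : ℤ, 0 ≤ i → i ≤ 4 * k₁ → w (i + 2) = 4 * k - 2 - w₁ i)
    (e₂ : ∀ i : ℤ, 0 ≤ i → i ≤ 4 * k₂ → w (4 * k₁ + 4 + i) = w₂ i) :
    evenList k w = lskew [0] (lskew (lcompl (oddList k₁ w₁)) (evenList k₂ w₂)) := by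
  rw [evenList, hk, show k₁ + 1 + k₂ + 1 = 1 + (k₁ + (k₂ + 1)) by ring, List.range_add,
    List.range_add, List.map_append, List.map_append, List.map_append, lskew]
  congr 1
  · simp [e₀]
    omega
  rw [lskew]
  congr 1
  · rw [length_evenList, lcompl, length_oddList, oddList, List.map_map, List.map_map,
      List.map_map]
    refine List.map_congr_left fun j hj => ?_
    rw [List.mem_range] at hj
    have := h₁.emod_four_two (i := 4 * j + 2) (by omega) (by omega) (by omega)
    simp only [Function.comp_apply]
    rw [show 4 * ((1 + j : ℕ) : ℤ) = 4 * j + 2 + 2 by push_cast; ring,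
      e₁ _ (by omega) (by omega)]
    omega
  · rw [evenList, List.map_map, List.map_map]
    refine List.map_congr_left fun j hj => ?_
    rw [List.mem_range] at hj
    rw [← e₂ _ (by omega) (by omega)]
    simp only [Function.comp_apply]
    congr 2
    push_cast
    ring

end Glue

theorem IsSnow.threads {k : ℕ} : ∀ {w p : ℤ → ℤ}, IsSnow k w p →
    Threads (oddList k w) (evenList k w) := by
  induction k using Nat.strong_induction_on with
  | _ k ih =>
    intro w p h
    rcases k.eq_zero_or_pos with rfl | hk
    · have := h.zero
      simp only [CharP.cast_eq_zero, mul_zero] at this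
      simpa [oddList, evenList, this] using Threads.nil
    obtain ⟨k₁, k₂, w₁, p₁, w₂, p₂, h₁, h₂, e, e₁, e₂⟩ := h.decomp (by omega)
    have n₁ := h₁.nonneg
    have n₂ := h₂.nonneg
    lift k₁ to ℕ using n₁
    lift k₂ to ℕ using n₂
    have e' : k = k₁ + 1 + k₂ := by omega
    rw [oddList_glue h₁ e' e₁ e₂, evenList_glue h₁ e' h.zero e₁ e₂]
    exact .node (ih k₁ (by omega) h₁) (ih k₂ (by omega) h₂)

theorem isSnow_zero : IsSnow 0 (fun _ => 0) (fun _ => 0) where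
  nonneg := le_rfl
  map i _ _ := by omega
  imap i _ _ := by omega
  left_inv i _ _ := by omega
  right_inv i _ _ := by omega
  zero := rfl
  last := rfl
  parity i _ _ := by omega
  baxter_odd v i _ _ := by omega
  baxter_even v i _ _ := by omega
  alt i _ _ := by omega
  ialt i _ _ := by omega

theorem Threads.exists_isSnow {β α : List ℤ} (h : Threads β α) :
    ∃ (k : ℕ) (w p : ℤ → ℤ), IsSnow k w p ∧ β = oddList k w ∧ α = evenList k w := by
  induction h with
  | nil => exact ⟨0, _, _, isSnow_zero, by simp [oddList], by simp [evenList]⟩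
  | node _ _ ih₁ ih₂ =>
    obtain ⟨k₁, w₁, p₁, h₁, rfl, rfl⟩ := ih₁
    obtain ⟨k₂, w₂, p₂, h₂, rfl, rfl⟩ := ih₂
    obtain ⟨w, p, h, e₁, e₂⟩ := h₁.exists_glue h₂
    have e : ((k₁ + 1 + k₂ : ℕ) : ℤ) = (k₁ : ℤ) + 1 + k₂ := by push_cast; ring
    rw [← e] at h e₁
    exact ⟨k₁ + 1 + k₂, w, p, h, (oddList_glue h₁ rfl e₁ e₂).symm,
      (evenList_glue h₁ rfl h.zero e₁ e₂).symm⟩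

/-! ### Between permutations of `Fin n` and framed permutations -/

open Equiv

/-- One-line notation, with entries starting from `0`. -/
def permList {n : ℕ} (π : Perm (Fin n)) : List ℤ := List.ofFn fun i => ((π i : ℕ) : ℤ)

@[simp] theorem length_permList {n : ℕ} (π : Perm (Fin n)) : (permList π).length = n := by
  simp [permList]

theorem perm_apply_inv {n : ℕ} (σ : Perm (Fin n)) (x : Fin n) : σ (σ⁻¹ x) = x :=
  σ.apply_symm_apply x

theorem perm_inv_apply {n : ℕ} (σ : Perm (Fin n)) (x : Fin n) : σ⁻¹ (σ x) = x :=
  σ.symm_apply_apply x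

/-- One-line notation of `1 ⊖ α ⊖ 1`. -/
def wall (a : List ℤ) : List ℤ := lskew [0] (lskew a [0])

theorem wall_injective : Function.Injective wall := by
  intro a b h
  have hl := congrArg List.length h
  simp only [wall, length_lskew, List.length_cons, List.length_nil] at hl
  simp only [wall, lskew, List.map_cons, List.map_nil, List.cons_append, List.nil_append,
    List.cons.injEq] at h
  have h2 := List.append_inj_left' h.2 rfl
  exact List.map_injective_iff.2 (add_left_injective _) h2

/-- The extension of a permutation of `[1, m]` by `0 ↦ m + 1` and `m + 1 ↦ 0`. -/
def extend {m : ℕ} (π : Perm (Fin m)) (i : ℤ) : ℤ :=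
  if i ≤ 0 then m + 1 else if h : i.toNat - 1 < m then (π ⟨i.toNat - 1, h⟩ : ℕ) + 1 else 0

section Extend

variable {m : ℕ} (π : Perm (Fin m))

theorem extend_zero : extend π 0 = m + 1 := by simp [extend]

theorem extend_succ (j : Fin m) : extend π ((j : ℕ) + 1) = (π j : ℕ) + 1 := by
  have e : (((j : ℕ) : ℤ) + 1).toNat - 1 = j := by omega
  rw [extend, if_neg (by omega), dif_pos (by omega)]
  simp only [e]

theorem extend_last : extend π (m + 1) = 0 := by
  rw [extend, if_neg (by omega), dif_neg (by omega)]

theorem extend_cases {i : ℤ} (h0 : 0 ≤ i) (h1 : i ≤ m + 1) :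
    i = 0 ∨ (∃ j : Fin m, i = (j : ℕ) + 1) ∨ i = m + 1 := by
  by_cases a : i = 0
  · exact Or.inl a
  by_cases b : i = m + 1
  · exact Or.inr (Or.inr b)
  exact Or.inr (Or.inl ⟨⟨(i - 1).toNat, by omega⟩, by simp only; omega⟩)

theorem extend_mem {i : ℤ} (h0 : 0 ≤ i) (h1 : i ≤ m + 1) :
    0 ≤ extend π i ∧ extend π i ≤ m + 1 := by
  rcases extend_cases h0 h1 with rfl | ⟨j, rfl⟩ | rfl
  · rw [extend_zero]; omega
  · rw [extend_succ]; have := (π j).2; omega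
  · rw [extend_last]; omega

theorem extend_inv_extend {i : ℤ} (h0 : 0 ≤ i) (h1 : i ≤ m + 1) :
    extend π⁻¹ (extend π i) = i := by
  rcases extend_cases h0 h1 with rfl | ⟨j, rfl⟩ | rfl
  · rw [extend_zero, extend_last]
  · rw [extend_succ, extend_succ]; simp
  · rw [extend_last, extend_zero]

theorem extend_extend_inv {i : ℤ} (h0 : 0 ≤ i) (h1 : i ≤ m + 1) :
    extend π (extend π⁻¹ i) = i := by
  have := extend_inv_extend π⁻¹ h0 h1
  rwa [inv_inv] at this

end Extend

/-- The frame adds no real constraint: for the value pairs `4k - 1, 4k` and `0, 1`, the Baxter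
condition only says that other entries differ from these two. -/
theorem isSnow_extend {n : ℕ} {w : Perm (Fin (2 * (2 * n + 1) + 1))}
    {b : Perm (Fin (2 * n + 1 + 1))} (hw : IsCompleteBaxter w) (hb : InducesOnOdd w b)
    (hd : IsDoublyAlternating b) :
    IsSnow ((n + 1 : ℕ) : ℤ) (extend w) (extend w⁻¹) := by
  have hM : 4 * ((n + 1 : ℕ) : ℤ) = ((2 * (2 * n + 1) + 1 : ℕ) : ℤ) + 1 := by push_cast; ring
  have hodd : ∀ j : Fin (2 * n + 1 + 1), extend w (2 * (j : ℕ) + 1) = 2 * (b j : ℕ) + 1 := by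
    intro j
    have := hb.2 j ⟨2 * j, by omega⟩ rfl
    have e := extend_succ w ⟨2 * j, by omega⟩
    rw [this] at e
    push_cast at e
    exact e
  have hiodd : ∀ j : Fin (2 * n + 1 + 1),
      extend w⁻¹ (2 * (j : ℕ) + 1) = 2 * (b⁻¹ j : ℕ) + 1 := by
    intro j
    have := hodd (b⁻¹ j)
    rw [perm_apply_inv] at this
    rw [← this, extend_inv_extend w (by omega) (by have := (b⁻¹ j).2; omega)]
  have halt : ∀ (f : ℤ → ℤ) (c : Perm (Fin (2 * n + 1 + 1))), IsAlternating c →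
      (∀ j : Fin (2 * n + 1 + 1), f (2 * (j : ℕ) + 1) = 2 * (c j : ℕ) + 1) →
      ∀ i, 0 ≤ i → i + 2 ≤ 4 * ((n + 1 : ℕ) : ℤ) →
        (i % 4 = 1 → f i < f (i + 2)) ∧ (i % 4 = 3 → f (i + 2) < f i) := by
    intro f c hc hf i h0 h1
    by_cases hi : i % 2 = 1
    · obtain ⟨j, hj⟩ : ∃ j : ℕ, i = 2 * j + 1 := ⟨(i / 2).toNat, by omega⟩
      have e₁ := hf ⟨j, by omega⟩
      have e₂ := hf ⟨j + 1, by omega⟩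
      have a := hc ⟨j, by omega⟩ ⟨j + 1, by omega⟩ rfl
      simp only [Fin.lt_def, Nat.even_iff, Nat.odd_iff] at a
      rw [show 2 * ((j + 1 : ℕ) : ℤ) + 1 = i + 2 by push_cast; omega] at e₂
      rw [← hj] at e₁
      rw [e₁, e₂]
      constructor <;> intro h4
      · have := a.1 (by omega); omega
      · have := a.2 (by omega); omega
    · omega
  have bax : ∀ v i : ℤ, 0 < v → v + 1 < 4 * ((n + 1 : ℕ) : ℤ) →
      (extend w⁻¹ v < i ∧ i < extend w⁻¹ (v + 1) ∨
        extend w⁻¹ (v + 1) < i ∧ i < extend w⁻¹ v) →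
      (v % 2 = 1 → extend w i < v) ∧ (v % 2 = 0 → v + 1 < extend w i) := by
    intro v i h0 h1 hb
    obtain ⟨a, rfl⟩ : ∃ a : ℕ, v = (a : ℤ) + 1 := ⟨(v - 1).toNat, by omega⟩
    have ha : a + 1 < 2 * (2 * n + 1) + 1 := by omega
    have e₁ := extend_succ w⁻¹ ⟨a, by omega⟩
    have e₂ := extend_succ w⁻¹ ⟨a + 1, by omega⟩
    simp only [Nat.cast_add, Nat.cast_one] at e₁ e₂
    rw [e₁, e₂] at hb
    have b₁ := (w⁻¹ ⟨a, by omega⟩).2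
    have b₂ := (w⁻¹ ⟨a + 1, by omega⟩).2
    obtain ⟨z, rfl⟩ : ∃ z : Fin (2 * (2 * n + 1) + 1), i = ((z : ℕ) : ℤ) + 1 :=
      ⟨⟨(i - 1).toNat, by omega⟩, by simp only; omega⟩
    have := hw.2 (w⁻¹ ⟨a, by omega⟩) (w⁻¹ ⟨a + 1, by omega⟩) z (by simp)
      (by simp only [Fin.lt_def]; omega)
    simp only [Fin.lt_def, Nat.even_iff, Nat.odd_iff, perm_apply_inv] at this
    rw [extend_succ]
    omega
  have hinj : ∀ i j : ℤ, 0 ≤ i → i ≤ 4 * ((n + 1 : ℕ) : ℤ) → extend w i = j →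
      extend w⁻¹ j = i := by
    rintro i j h0 h1 rfl
    exact extend_inv_extend w h0 (by omega)
  have hlast : extend w⁻¹ (4 * ((n + 1 : ℕ) : ℤ)) = 0 := by rw [hM, extend_last]
  have hzero : extend w⁻¹ 0 = 4 * ((n + 1 : ℕ) : ℤ) := by rw [hM, extend_zero]
  constructor
  · omega
  · intro i h0 h1
    rw [hM] at h1 ⊢
    exact extend_mem w h0 h1
  · intro i h0 h1
    rw [hM] at h1 ⊢
    exact extend_mem w⁻¹ h0 h1
  · intro i h0 h1
    exact extend_inv_extend w h0 (by omega)
  · intro i h0 h1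
    exact extend_extend_inv w h0 (by omega)
  · rw [extend_zero, hM]
  · rw [hM, extend_last]
  · intro i h0 h1
    rcases extend_cases (m := 2 * (2 * n + 1) + 1) h0 (by omega) with rfl | ⟨j, rfl⟩ | rfl
    · rw [extend_zero]; omega
    · have := hw.1 j
      rw [Nat.even_iff, Nat.even_iff] at this
      rw [extend_succ]
      omega
    · rw [extend_last]; omega
  · intro v i h0 h1 hv hb
    rcases h1.lt_or_eq with h1 | h1
    · exact (bax v i (by omega) h1 hb).1 hv
    · rw [h1, hlast] at hb
      have hp := extend_mem w⁻¹ h0 (by omega)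
      have hm := extend_mem w (i := i) (by omega) (by omega)
      have n1 : extend w i ≠ v := by
        intro e; have := hinj i v (by omega) (by omega) e; omega
      have n2 : extend w i ≠ 4 * ((n + 1 : ℕ) : ℤ) := by
        intro e; have := hinj i _ (by omega) (by omega) e; omega
      omega
  · intro v i h0 h1 hv hb
    rcases h0.eq_or_lt with rfl | h0
    · rw [zero_add, hzero] at hb
      have hp := extend_mem w⁻¹ (i := 1) (by omega) (by omega)
      have hm := extend_mem w (i := i) (by omega) (by omega)
      have n1 : extend w i ≠ 0 := by
        intro e; have := hinj i _ (by omega) (by omega) e; omega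
      have n2 : extend w i ≠ 1 := by
        intro e; have := hinj i _ (by omega) (by omega) e; omega
      omega
    · exact (bax v i h0 (by omega) hb).2 hv
  · exact halt _ b hd.1 hodd
  · exact halt _ b⁻¹ hd.2 hiodd

theorem Entangled.threads {a b : ℕ} {α : Perm (Fin a)} {β : Perm (Fin b)}
    (h : Entangled α β) : Threads (permList β) (wall (permList α)) := by
  obtain ⟨n, π, ⟨-, c, -, hd, w, hw, hc, hπ⟩, ⟨ha, hα⟩, ⟨hb, hβ⟩⟩ := h
  have hs := isSnow_extend hw hc hd
  have e₁ : permList β = oddList (n + 1) (extend w) := by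
    apply List.ext_getElem
    · simp; omega
    · intro j h₁ h₂
      rw [length_permList] at h₁
      have x := hβ ⟨j, h₁⟩ ⟨2 * j, by omega⟩ rfl
      have y := hπ.2 ⟨2 * j, by omega⟩ ⟨2 * (2 * j) + 1, by omega⟩ rfl
      have z := extend_succ w ⟨2 * (2 * j) + 1, by omega⟩
      rw [y, x] at z
      simp only [permList, oddList, List.getElem_ofFn, List.getElem_map, List.getElem_range]
      rw [show 4 * (j : ℤ) + 2 = ((2 * (2 * j) + 1 : ℕ) : ℤ) + 1 by push_cast; ring, z]
      omega
  have e₂ : wall (permList α) = evenList (n + 1) (extend w) := by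
    apply List.ext_getElem
    · simp [wall]; omega
    · intro j h₁ h₂
      have l : (n + 1 + 1 : ℕ) = a + 2 := by omega
      rw [length_evenList] at h₂
      simp only [evenList, List.getElem_map, List.getElem_range, wall, lskew]
      rcases j with _ | j
      · simp [extend_zero]
        omega
      · simp only [List.map_cons, List.map_nil, List.cons_append, List.nil_append,
          List.getElem_cons_succ, List.length_singleton]
        by_cases hj : j < a
        · rw [List.getElem_append_left (by simpa using hj)]
          have x := hα ⟨j, hj⟩ ⟨2 * j + 1, by omega⟩ rfl
          have y := hπ.2 ⟨2 * j + 1, by omega⟩ ⟨2 * (2 * j + 1) + 1, by omega⟩ rfl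
          have z := extend_succ w ⟨2 * (2 * j + 1) + 1, by omega⟩
          rw [y, x] at z
          rw [show 4 * ((j + 1 : ℕ) : ℤ) = ((2 * (2 * j + 1) + 1 : ℕ) : ℤ) + 1 by
            push_cast; ring, z]
          simp only [permList, List.getElem_map, List.getElem_ofFn]
          push_cast
          omega
        · rw [List.getElem_append_right (by simpa using hj)]
          rw [show 4 * ((j + 1 : ℕ) : ℤ) = ((2 * (2 * n + 1) + 1 : ℕ) : ℤ) + 1 by omega,
            extend_last]
          simp
  rw [e₁, e₂]
  exact hs.threads

theorem exists_perm_of_int {m : ℕ} {f g : ℤ → ℤ}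
    (hf : ∀ i : ℤ, 0 ≤ i → i < m → 0 ≤ f i ∧ f i < m ∧ g (f i) = i)
    (hg : ∀ i : ℤ, 0 ≤ i → i < m → 0 ≤ g i ∧ g i < m ∧ f (g i) = i) :
    ∃ σ : Perm (Fin m), (∀ i : Fin m, ((σ i : ℕ) : ℤ) = f (i : ℕ)) ∧
      ∀ i : Fin m, ((σ⁻¹ i : ℕ) : ℤ) = g (i : ℕ) := by
  have F : ∀ i : Fin m, _ := fun i => hf (i : ℕ) (by omega) (by omega)
  have G : ∀ i : Fin m, _ := fun i => hg (i : ℕ) (by omega) (by omega)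
  refine ⟨⟨fun i => ⟨(f (i : ℕ)).toNat, by have := F i; omega⟩,
    fun i => ⟨(g (i : ℕ)).toNat, by have := G i; omega⟩, fun i => ?_, fun i => ?_⟩, ?_, ?_⟩
  · have := F i
    ext
    simp only [Int.toNat_of_nonneg this.1, this.2.2]
    omega
  · have := G i
    ext
    simp only [Int.toNat_of_nonneg this.1, this.2.2]
    omega
  · intro i
    exact Int.toNat_of_nonneg (F i).1
  · intro i
    exact Int.toNat_of_nonneg (G i).1

/-- Entries at positions congruent to `c` modulo `d`, when these are also the entries congruent to
`c` modulo `d`, form a permutation. -/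
theorem IsSnow.exists_perm {n : ℕ} {w p : ℤ → ℤ} (h : IsSnow ((n + 1 : ℕ) : ℤ) w p) (d c : ℤ)
    (m : ℕ) (hd : 0 < d) (hc : 0 < c) (hcd : c ≤ d)
    (hm : ∀ i, 0 ≤ i → (d * i + c < 4 * n + 4 ↔ i < m))
    (hw : ∀ i : ℤ, 0 < i → i < 4 * n + 4 → i % d = c % d → w i % d = c % d)
    (hp : ∀ i : ℤ, 0 < i → i < 4 * n + 4 → i % d = c % d → p i % d = c % d) :
    ∃ σ : Perm (Fin m), (∀ i : Fin m, w (d * (i : ℕ) + c) = d * (σ i : ℕ) + c) ∧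
      ∀ i : Fin m, p (d * (i : ℕ) + c) = d * (σ⁻¹ i : ℕ) + c := by
  have key : ∀ {w p : ℤ → ℤ}, IsSnow ((n + 1 : ℕ) : ℤ) w p →
      (∀ i : ℤ, 0 < i → i < 4 * n + 4 → i % d = c % d → w i % d = c % d) →
      ∀ i : ℤ, 0 ≤ i → i < m → 0 ≤ (w (d * i + c) - c) / d ∧ (w (d * i + c) - c) / d < m ∧
        d * ((w (d * i + c) - c) / d) + c = w (d * i + c) := by
    intro w p h hw i h0 h1
    have i1 := (hm i h0).2 h1
    have i0 : 0 ≤ d * i := mul_nonneg hd.le h0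
    have a := hw (d * i + c) (by omega) i1 (by simp)
    have q := h.left_inv (d * i + c) (by omega) (by push_cast; omega)
    have m := h.map (d * i + c) (by omega) (by push_cast; omega)
    have z := h.symm.zero
    have l := h.symm.last
    have n1 : w (d * i + c) ≠ 0 := by intro e; rw [e, z] at q; push_cast at q; omega
    have n2 : w (d * i + c) ≠ 4 * ((n + 1 : ℕ) : ℤ) := by
      intro e; rw [e, l] at q; omega
    push_cast at m n2
    have dv : d ∣ w (d * i + c) - c := Int.ModEq.dvd (Eq.symm a)
    obtain ⟨t, ht⟩ := dv
    have e : (w (d * i + c) - c) / d = t := by rw [ht, Int.mul_ediv_cancel_left _ hd.ne']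
    rw [e]
    have t0 : 0 ≤ t := by
      by_contra hneg
      have : d * t ≤ d * (-1) := mul_le_mul_of_nonneg_left (by omega) hd.le
      omega
    exact ⟨t0, (hm t t0).1 (by omega), by omega⟩
  have kw := key h hw
  have kp := key h.symm hp
  obtain ⟨σ, h₁, h₂⟩ := exists_perm_of_int (m := m) (f := fun i => (w (d * i + c) - c) / d)
    (g := fun i => (p (d * i + c) - c) / d)
    (fun i h0 h1 => by
      have i0 : 0 ≤ d * i := mul_nonneg hd.le h0
      have := (hm i h0).2 h1
      refine ⟨(kw i h0 h1).1, (kw i h0 h1).2.1, ?_⟩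
      rw [(kw i h0 h1).2.2, h.left_inv _ (by omega) (by push_cast; omega), add_sub_cancel_right,
        Int.mul_ediv_cancel_left _ hd.ne'])
    (fun i h0 h1 => by
      have i0 : 0 ≤ d * i := mul_nonneg hd.le h0
      have := (hm i h0).2 h1
      refine ⟨(kp i h0 h1).1, (kp i h0 h1).2.1, ?_⟩
      rw [(kp i h0 h1).2.2, h.right_inv _ (by omega) (by push_cast; omega), add_sub_cancel_right,
        Int.mul_ediv_cancel_left _ hd.ne'])
  refine ⟨σ, fun i => ?_, fun i => ?_⟩
  · rw [h₁ i]; exact ((kw i (by omega) (by omega)).2.2).symm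
  · rw [h₂ i]; exact ((kp i (by omega) (by omega)).2.2).symm

/-- All permutations involved are restrictions of `w` to residue classes: mod 4 for the two threads,
mod 2 for the snow leopard permutation and the Baxter permutation, mod 1 for the complete Baxter
permutation. -/
theorem IsSnow.entangled {n : ℕ} {w p : ℤ → ℤ} (h : IsSnow ((n + 1 : ℕ) : ℤ) w p) :
    ∃ (α : Perm (Fin n)) (β : Perm (Fin (n + 1))), Entangled α β ∧
      permList β = oddList (n + 1) w ∧ wall (permList α) = evenList (n + 1) w := by
  have hM : 4 * ((n + 1 : ℕ) : ℤ) = 4 * n + 4 := by push_cast; ring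
  obtain ⟨α, hα, -⟩ := h.exists_perm 4 4 n (by omega) (by omega) (by omega)
    (by intro i _; omega) (fun i a b c => h.emod_four (by omega) (by omega) (by omega))
    (fun i a b c => h.symm.emod_four (by omega) (by omega) (by omega))
  obtain ⟨β, hβ, -⟩ := h.exists_perm 4 2 (n + 1) (by omega) (by omega) (by omega)
    (by intro i _; omega) (fun i a b c => h.emod_four_two (by omega) (by omega) (by omega))
    (fun i a b c => h.symm.emod_four_two (by omega) (by omega) (by omega))
  have w2 := h.parity
  have p2 := h.symm.parity
  obtain ⟨π, hπ, -⟩ := h.exists_perm 2 2 (2 * n + 1) (by omega) (by omega) (by omega)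
    (by intro i _; omega) (fun i a b c => (w2 i (by omega) (by omega)).trans c)
    (fun i a b c => (p2 i (by omega) (by omega)).trans c)
  obtain ⟨b, hb, hb'⟩ := h.exists_perm 2 1 (2 * n + 1 + 1) (by omega) (by omega) (by omega)
    (by intro i _; omega) (fun i a b c => (w2 i (by omega) (by omega)).trans c)
    (fun i a b c => (p2 i (by omega) (by omega)).trans c)
  obtain ⟨u, hu, hu'⟩ := h.exists_perm 1 1 (2 * (2 * n + 1) + 1) (by omega) (by omega) (by omega)
    (by intro i _; omega) (fun i a b c => by omega) (fun i a b c => by omega)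
  simp only [one_mul] at hu hu'
  have cb : IsCompleteBaxter u := by
    constructor
    · intro x
      have := w2 ((x : ℕ) + 1) (by omega) (by omega)
      rw [hu] at this
      rw [Nat.even_iff, Nat.even_iff]
      omega
    · intro x y z hxy hz
      have b₁ := hu' (u x)
      have b₂ := hu' (u y)
      rw [perm_inv_apply] at b₁ b₂
      have c := hu z
      have e : (((u y : ℕ) : ℤ)) + 1 = (((u x : ℕ) : ℤ)) + 1 + 1 := by omega
      rw [e] at b₂
      have lx := (u x).2
      have ly := (u y).2
      have hb : p ((u x : ℕ) + 1) < (z : ℕ) + 1 ∧ (z : ℕ) + 1 < p ((u x : ℕ) + 1 + 1) ∨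
          p ((u x : ℕ) + 1 + 1) < (z : ℕ) + 1 ∧ (z : ℕ) + 1 < p ((u x : ℕ) + 1) := by
        rw [b₁, b₂]
        simp only [Fin.lt_def] at hz
        omega
      simp only [Fin.lt_def, Nat.even_iff, Nat.odd_iff]
      constructor <;> intro hp
      · have := h.baxter_odd _ _ (by omega) (by omega) (by omega) hb
        omega
      · have := h.baxter_even _ _ (by omega) (by omega) (by omega) hb
        omega
  have od : InducesOnOdd u b := by
    refine ⟨by omega, fun j i hij => ?_⟩
    have x := hu i
    have y := hb j
    rw [show 2 * (((j : ℕ)) : ℤ) + 1 = ((i : ℕ) : ℤ) + 1 by omega] at y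
    omega
  have ev : InducesOnEven u π := by
    refine ⟨by omega, fun j i hij => ?_⟩
    have x := hu i
    have y := hπ j
    rw [show 2 * (((j : ℕ)) : ℤ) + 2 = ((i : ℕ) : ℤ) + 1 by omega] at y
    omega
  have alt : ∀ (f : ℤ → ℤ) (c : Perm (Fin (2 * n + 1 + 1))),
      (∀ j : Fin (2 * n + 1 + 1), f (2 * (j : ℕ) + 1) = 2 * (c j : ℕ) + 1) →
      (∀ i, 0 ≤ i → i + 2 ≤ 4 * ((n + 1 : ℕ) : ℤ) →
        (i % 4 = 1 → f i < f (i + 2)) ∧ (i % 4 = 3 → f (i + 2) < f i)) → IsAlternating c := by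
    intro f c hf ha i j hij
    have x := hf i
    have y := hf j
    have a := ha (2 * (i : ℕ) + 1) (by omega) (by omega)
    rw [show 2 * (((j : ℕ)) : ℤ) + 1 = 2 * (i : ℕ) + 1 + 2 by omega] at y
    simp only [Fin.lt_def, Nat.even_iff, Nat.odd_iff]
    constructor <;> intro hp
    · have := a.1 (by omega); omega
    · have := a.2 (by omega); omega
  have hsl : IsSnowLeopard π :=
    ⟨⟨u, cb, ev⟩, b, ⟨u, cb, od⟩, ⟨alt w b hb h.alt, alt p b⁻¹ hb' h.ialt⟩, u, cb, od, ev⟩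
  refine ⟨α, β, ⟨n, π, hsl, ⟨by omega, fun j i hij => ?_⟩, ⟨by omega, fun j i hij => ?_⟩⟩,
    ?_, ?_⟩
  · have x := hπ i
    have y := hα j
    rw [show 4 * (((j : ℕ)) : ℤ) + 4 = 2 * (i : ℕ) + 2 by omega] at y
    omega
  · have x := hπ i
    have y := hβ j
    rw [show 4 * (((j : ℕ)) : ℤ) + 2 = 2 * (i : ℕ) + 2 by omega] at y
    omega
  · apply List.ext_getElem
    · simp
    · intro j h₁ h₂
      rw [length_permList] at h₁
      have := hβ ⟨j, h₁⟩
      simp only [permList, oddList, List.getElem_ofFn, List.getElem_map, List.getElem_range]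
      rw [this]
      omega
  · apply List.ext_getElem
    · simp [wall]; omega
    · intro j h₁ h₂
      rw [length_evenList] at h₂
      simp only [evenList, List.getElem_map, List.getElem_range, wall, lskew]
      rcases j with _ | j
      · simp [h.zero]
      · simp only [List.map_cons, List.map_nil, List.cons_append, List.nil_append,
          List.getElem_cons_succ, List.length_singleton]
        by_cases hj : j < n
        · rw [List.getElem_append_left (by simpa using hj)]
          have := hα ⟨j, hj⟩
          rw [show 4 * ((j + 1 : ℕ) : ℤ) = 4 * j + 4 by push_cast; ring, this]
          simp only [permList, List.getElem_map, List.getElem_ofFn]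
          omega
        · rw [List.getElem_append_right (by simpa using hj)]
          rw [show 4 * ((j + 1 : ℕ) : ℤ) = 4 * ((n + 1 : ℕ) : ℤ) by omega, h.last]
          simp

theorem permList_injective : Function.Injective
    (fun α : Σ n : ℕ, Perm (Fin n) => permList α.2) := by
  rintro ⟨n, σ⟩ ⟨m, τ⟩ h
  obtain rfl : n = m := by simpa using congrArg List.length h
  simp only [permList, List.ofFn_inj] at h
  congr
  ext i
  have := congrFun h i
  omega

theorem Threads.exists_entangled {β α : List ℤ} (h : Threads β α) (hβ : β ≠ []) :
    ∃ (n : ℕ) (σ : Perm (Fin n)) (τ : Perm (Fin (n + 1))), Entangled σ τ ∧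
      permList τ = β ∧ wall (permList σ) = α := by
  obtain ⟨k, w, p, hs, rfl, rfl⟩ := h.exists_isSnow
  obtain ⟨n, rfl⟩ : ∃ n, k = n + 1 := by
    refine ⟨k - 1, ?_⟩
    rcases k with _ | k
    · simp [oddList] at hβ
    · omega
  obtain ⟨α, β, h₁, h₂, h₃⟩ := hs.entangled
  exact ⟨n, α, β, h₁, h₂, h₃⟩

/-- Positive length excludes the seed pair `([], [0])`, which belongs to `k = 0` and to no snow
leopard permutation. -/
theorem encard_evenThreads {b : ℕ} (β : Perm (Fin b)) (hb : 0 < b) :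
    (evenThreadsEntangledWith β).encard = {α | Threads (permList β) α}.encard := by
  rw [← (wall_injective.comp permList_injective).encard_image (evenThreadsEntangledWith β)]
  congr 1
  ext α
  simp only [evenThreadsEntangledWith, Set.mem_image, Set.mem_ofPred_eq, Function.comp_apply]
  constructor
  · rintro ⟨σ, ⟨-, h⟩, rfl⟩
    exact h.threads
  · intro h
    obtain ⟨n, σ, τ, he, h₁, h₂⟩ := h.exists_entangled
      (fun e => by simpa [hb.ne'] using congrArg List.length e)
    cases permList_injective (a₁ := ⟨_, τ⟩) (a₂ := ⟨_, β⟩) h₁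
    obtain ⟨N, π, hπ, h₃, h₄⟩ := he
    exact ⟨⟨n, σ⟩, ⟨⟨N, π, hπ, h₃⟩, N, π, hπ, h₃, h₄⟩, h₂⟩

theorem encard_oddThreads {a : ℕ} (α : Perm (Fin a)) :
    (oddThreadsEntangledWith α).encard = {β | Threads β (wall (permList α))}.encard := by
  rw [← permList_injective.encard_image (oddThreadsEntangledWith α)]
  congr 1
  ext β
  simp only [oddThreadsEntangledWith, Set.mem_image, Set.mem_ofPred_eq]
  constructor
  · rintro ⟨σ, ⟨-, h⟩, rfl⟩
    exact h.threads
  · intro h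
    have hl := h.length
    simp only [wall, length_lskew, length_permList, List.length_singleton] at hl
    obtain ⟨n, σ, τ, he, h₁, h₂⟩ := h.exists_entangled
      (by rintro rfl; simp only [List.length_nil] at hl; omega)
    cases permList_injective (a₁ := ⟨_, σ⟩) (a₂ := ⟨_, α⟩) (wall_injective h₂)
    obtain ⟨N, π, hπ, h₃, h₄⟩ := he
    exact ⟨⟨_, τ⟩, ⟨⟨N, π, hπ, h₄⟩, N, π, hπ, h₃, h₄⟩, h₁⟩

/-! ### Counting partners of increasing and decreasing blocks -/

theorem encard_exists_lt {γ : Type*} (S : ℕ → Set γ) (n : ℕ)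
    (h : ∀ i j, i < n → j < n → ∀ x, x ∈ S i → x ∈ S j → i = j) :
    {x | ∃ i < n, x ∈ S i}.encard = ∑ i ∈ Finset.range n, (S i).encard := by
  induction n with
  | zero => simp
  | succ n ih =>
    rw [Finset.sum_range_succ, ← ih fun i j hi hj => h i j (by omega) (by omega),
      ← Set.encard_union_eq]
    · congr 1
      ext x
      constructor
      · rintro ⟨i, hi, hx⟩
        rcases Nat.lt_succ_iff_lt_or_eq.1 hi with hi | rfl
        · exact Or.inl ⟨i, hi, hx⟩
        · exact Or.inr hx
      · rintro (⟨i, hi, hx⟩ | hx)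
        · exact ⟨i, by omega, hx⟩
        · exact ⟨n, by omega, hx⟩
    · rw [Set.disjoint_left]
      rintro x ⟨i, hi, hx⟩ hx'
      have := h i n (by omega) (by omega) x hx hx'
      omega

theorem motzkin_pos (n : ℕ) : 0 < motzkin n := by
  induction n with
  | zero => simp [motzkin]
  | succ n ih => rw [motzkin]; omega

theorem lskew_inj {a b c d : List ℤ} (h : lskew a b = lskew c d) (hl : b.length = d.length) :
    a = c ∧ b = d := by
  obtain ⟨h₁, h₂⟩ := List.append_inj' h hl
  rw [hl] at h₁
  exact ⟨List.map_injective_iff.2 (add_left_injective _) h₁, h₂⟩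

@[simp] theorem lskew_nil (a : List ℤ) : lskew a [] = a := by simp [lskew]

/-- Direct sum in one-line notation. -/
def ldirect (a b : List ℤ) : List ℤ := a ++ b.map (· + (a.length : ℤ))

theorem lcompl_ldirect (a b : List ℤ) : lcompl (ldirect a b) = lskew (lcompl a) (lcompl b) := by
  simp only [lcompl, ldirect, lskew, List.map_append, List.map_map, List.length_append,
    List.length_map]
  congr 1 <;> refine List.map_congr_left fun x _ => ?_ <;> simp only [Function.comp_apply] <;>
    push_cast <;> ring

/-- `1 2 ⋯ n` in one-line notation. -/
def lincr (n : ℕ) : List ℤ := (List.range n).map fun i : ℕ => (i : ℤ)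

@[simp] theorem length_lincr (n : ℕ) : (lincr n).length = n := by simp [lincr]

theorem lincr_succ (n : ℕ) : lincr (n + 1) = 0 :: (lincr n).map (· + 1) := by
  simp [lincr, List.range_succ_eq_map]

theorem lincr_add (m n : ℕ) : lincr (m + n) = ldirect (lincr m) (lincr n) := by
  simp only [lincr, ldirect, List.range_add, List.map_append, List.map_map, List.length_map,
    List.length_range]
  congr 1
  refine List.map_congr_left fun x _ => ?_
  simp only [Function.comp_apply]
  push_cast
  ring

theorem lcompl_lincr_add (m n : ℕ) :
    lcompl (lincr (m + n)) = lskew (lcompl (lincr m)) (lcompl (lincr n)) := by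
  rw [lincr_add, lcompl_ldirect]

theorem lcompl_lincr_one : lcompl (lincr 1) = [0] := by simp [lcompl, lincr]

theorem Threads.exists_cons {β α : List ℤ} (h : Threads β α) :
    ∃ t, α = (β.length : ℤ) :: t := by
  cases h with
  | nil => exact ⟨[], rfl⟩
  | @node β₁ α₁ β₂ α₂ h₁ h₂ =>
    refine ⟨lskew (lcompl β₁) α₂, ?_⟩
    simp only [lskew, lcompl, List.map_cons, List.map_nil, List.cons_append, List.nil_append,
      List.length_append, List.length_map, h₁.length, h₂.length, zero_add]
    congr 2
    ring

/-- Since `α` starts with its maximum, its complement starts with 0. The first entry of an odd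
thread therefore reveals where it is cut. -/
theorem Threads.head_lskew {β α : List ℤ} (h : Threads β α) (γ : List ℤ) :
    (lskew (lcompl α) γ).head? = some (γ.length : ℤ) := by
  have hl := h.length
  obtain ⟨t, rfl⟩ := h.exists_cons
  simp only [List.length_cons] at hl
  simp [lskew, lcompl]
  omega

theorem setOf_threads_nil : {α | Threads [] α} = {[0]} := by
  ext α
  simp only [Set.mem_ofPred_eq, Set.mem_singleton_iff]
  refine ⟨fun h => ?_, by rintro rfl; exact .nil⟩
  generalize hβ : ([] : List ℤ) = β at h
  cases h with
  | nil => rfl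
  | node h₁ h₂ =>
    have := congrArg List.length hβ
    have := h₁.length
    simp only [length_lskew, length_lcompl, List.length_nil] at *
    omega

/-- The first entry is the length of `u`, so the only possible cut is right after the increasing
block. -/
theorem encard_threads_lskew_lincr (l : ℕ) (u : List ℤ) :
    {α | Threads (lskew (lincr (l + 1)) u) α}.encard =
      {β | Threads β (lcompl (lincr (l + 1)))}.encard * {α | Threads u α}.encard := by
  rw [← Set.encard_prod]
  have hinj : Set.InjOn (fun x : List ℤ × List ℤ => lskew [0] (lskew (lcompl x.1) x.2))
      ({β | Threads β (lcompl (lincr (l + 1)))} ×ˢ {α | Threads u α}) := by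
    rintro ⟨b, a⟩ ⟨hb, ha⟩ ⟨b', a'⟩ ⟨hb', ha'⟩ h
    have l₁ := Threads.length hb
    have l₂ := Threads.length hb'
    have l₃ := Threads.length ha
    have l₄ := Threads.length ha'
    simp only at l₁ l₂ l₃ l₄ h
    have h₁ := (lskew_inj h (by simp; omega)).2
    have h₂ := lskew_inj h₁ (by omega)
    rw [Prod.mk.injEq]
    exact ⟨lcompl_injective h₂.1, h₂.2⟩
  rw [← hinj.encard_image]
  congr 1
  ext α
  simp only [Set.mem_ofPred_eq, Set.mem_image, Set.mem_prod, Prod.exists]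
  constructor
  · intro h
    generalize hβ : lskew (lincr (l + 1)) u = β at h
    cases h with
    | nil => simpa using congrArg List.length hβ
    | @node β₁ α₁ β₂ α₂ h₁ h₂ =>
      have hh := congrArg List.head? hβ
      rw [h₁.head_lskew, lincr_succ] at hh
      have hl : u.length = β₂.length := by simpa [lskew] using hh
      obtain ⟨e₁, rfl⟩ := lskew_inj hβ hl
      refine ⟨β₁, α₂, ⟨?_, h₂⟩, rfl⟩
      rw [e₁, lcompl_lcompl]
      exact h₁
  · rintro ⟨b, a, ⟨hb, ha⟩, rfl⟩
    have := Threads.node hb ha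
    rwa [lcompl_lcompl] at this

theorem encard_threads_lincr (l : ℕ) :
    {α | Threads (lincr (l + 1)) α}.encard =
      {β | Threads β (lcompl (lincr (l + 1)))}.encard := by
  have := encard_threads_lskew_lincr l []
  rwa [lskew_nil, setOf_threads_nil, Set.encard_singleton, mul_one] at this

/-- A decreasing word can be cut as `1 ⊖ J_i ⊖ J_{n-i+1}` for each `i`; the two factors count
partners of `I_i` and of `J_{n-i+1}`, and those of `I_i` reduce to those of `J_i` when `i > 0`. -/
theorem encard_threads_lcompl_lincr (n : ℕ) :
    {β | Threads β (lcompl (lincr (n + 1)))}.encard = (motzkin n : ℕ) := by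
  induction n using Nat.strong_induction_on with
  | _ n ih =>
  rcases n with _ | n
  · rw [zero_add, lcompl_lincr_one]
    have : {β | Threads β [0]} = {[]} := by
      ext β
      simp only [Set.mem_ofPred_eq, Set.mem_singleton_iff]
      refine ⟨fun h => ?_, by rintro rfl; exact .nil⟩
      have := h.length
      exact List.length_eq_zero_iff.1 (by simpa using this)
    simp [this, motzkin]
  set S : ℕ → Set (List ℤ) := fun i => (fun x : List ℤ × List ℤ => lskew (lcompl x.1) x.2) ''
    ({α | Threads (lincr i) α} ×ˢ {β | Threads β (lcompl (lincr (n - i + 1)))}) with hS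
  have hset : {β | Threads β (lcompl (lincr (n + 1 + 1)))} = {x | ∃ i < n + 1, x ∈ S i} := by
    ext β
    simp only [hS, Set.mem_ofPred_eq, Set.mem_image, Set.mem_prod, Prod.exists]
    constructor
    · intro h
      generalize hα : lcompl (lincr (n + 1 + 1)) = α at h
      cases h with
      | nil => simpa using congrArg List.length hα
      | @node β₁ α₁ β₂ α₂ h₁ h₂ =>
        have hl := congrArg List.length hα
        have l₂ := h₂.length
        simp only [length_lcompl, length_lskew, length_lincr, List.length_singleton] at hl
        have hi : β₁.length ≤ n := by omega
        rw [show n + 1 + 1 = 1 + (β₁.length + (n - β₁.length + 1)) by omega,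
          lcompl_lincr_add, lcompl_lincr_add, lcompl_lincr_one] at hα
        have e := (lskew_inj hα (by simp; omega)).2
        obtain ⟨e₁, e₂⟩ := lskew_inj e (by simp; omega)
        refine ⟨β₁.length, by omega, α₁, β₂, ⟨?_, ?_⟩, rfl⟩
        · rw [lcompl_injective e₁]; exact h₁
        · rw [e₂]; exact h₂
    · rintro ⟨i, hi, a, b, ⟨ha, hb⟩, rfl⟩
      have := Threads.node ha hb
      rwa [← lcompl_lincr_add, ← lcompl_lincr_one, ← lcompl_lincr_add,
        show 1 + (i + (n - i + 1)) = n + 1 + 1 by omega] at this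
  have hlen : ∀ i b, Threads b (lcompl (lincr (n - i + 1))) → b.length = n - i := by
    intro i b h
    have := h.length
    simp only [length_lcompl, length_lincr] at this
    omega
  rw [hset, encard_exists_lt]
  · have hcard : ∀ i, (S i).encard =
        {α | Threads (lincr i) α}.encard * {β | Threads β (lcompl (lincr (n - i + 1)))}.encard := by
      intro i
      rw [← Set.encard_prod]
      apply Set.InjOn.encard_image
      rintro ⟨a, b⟩ ⟨ha, hb⟩ ⟨a', b'⟩ ⟨ha', hb'⟩ h
      obtain ⟨e₁, e₂⟩ := lskew_inj h ((hlen i _ hb).trans (hlen i _ hb').symm)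
      rw [Prod.mk.injEq]
      exact ⟨lcompl_injective e₁, e₂⟩
    -- The term `i = 0` has the single partner `[0]` and gives `M_n`; the term `i + 1` gives `M_i
    -- M_{n-1-i}`.
    rw [Finset.sum_range_succ', hcard 0, show lincr 0 = [] by rfl, setOf_threads_nil,
      Set.encard_singleton, one_mul, Nat.sub_zero, ih n (by omega), motzkin, Finset.sum_range]
    push_cast
    rw [add_comm]
    congr 1
    refine Finset.sum_congr rfl fun i _ => ?_
    rw [hcard, encard_threads_lincr, ih i (by omega), show n - (i + 1) = n - 1 - i by omega,
      ih (n - 1 - i) (by omega)]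
  -- The first entry is `n - i`, so different cuts give disjoint sets.
  · rintro i j hi hj x ⟨⟨a, b⟩, ⟨ha, hb⟩, rfl⟩ ⟨⟨a', b'⟩, ⟨ha', hb'⟩, h⟩
    have hh := congrArg List.head? h
    simp only at ha ha' hh
    rw [Threads.head_lskew ha, Threads.head_lskew ha', hlen i _ hb, hlen j _ hb'] at hh
    simp only [Option.some.injEq] at hh
    omega

/-! ### Partners of a framed even thread -/

theorem Threads.mem_bounds {β α : List ℤ} (h : Threads β α) :
    (∀ x ∈ β, 0 ≤ x ∧ x < β.length) ∧ ∀ x ∈ α, 0 ≤ x ∧ x ≤ β.length := by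
  induction h with
  | nil => simp
  | @node β₁ α₁ β₂ α₂ h₁ h₂ ih₁ ih₂ =>
    have l₁ := h₁.length
    have l₂ := h₂.length
    constructor
    · intro x hx
      simp only [lskew, lcompl, List.mem_append, List.mem_map] at hx
      simp only [length_lskew, length_lcompl]
      rcases hx with ⟨_, ⟨y, hy, rfl⟩, rfl⟩ | hx
      · have := ih₁.2 y hy; omega
      · have := ih₂.1 x hx; omega
    · intro x hx
      simp only [lskew, lcompl, List.mem_append, List.mem_map, List.mem_singleton] at hx
      simp only [length_lskew, length_lcompl]
      rcases hx with ⟨_, rfl, rfl⟩ | ⟨_, ⟨y, hy, rfl⟩, rfl⟩ | hx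
      · simp; omega
      · have := ih₁.1 y hy; omega
      · have := ih₂.2 x hx; omega

/-- A cut inside `d` would make `d` start at least as high as it ends. So the cut falls just before
the closing frame entry, and the odd thread is the complement of a partner of `dᶜ`. -/
theorem encard_threads_wall {d : List ℤ} {x y : ℤ} (hx : d.head? = some x)
    (hy : d.getLast? = some y) (hxy : x < y) :
    {β | Threads β (wall d)}.encard = {α | Threads (lcompl d) α}.encard := by
  have hinj : Function.Injective fun a : List ℤ => lskew (lcompl a) [] := by
    intro a b h
    simp only [lskew_nil] at h
    exact lcompl_injective h
  rw [← hinj.encard_image {α | Threads (lcompl d) α}]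
  congr 1
  ext β
  simp only [Set.mem_ofPred_eq, Set.mem_image]
  constructor
  · intro h
    generalize hα : wall d = α at h
    cases h with
    | nil =>
      have := congrArg List.length hα
      simp [wall] at this
    | @node β₁ α₁ β₂ α₂ h₁ h₂ =>
      have hl := congrArg List.length hα
      simp only [wall, length_lskew, length_lcompl, List.length_singleton] at hl
      have e := (lskew_inj hα (by simp; omega)).2
      have l₂ := h₂.length
      by_cases hb : β₂.length = 0
      · obtain rfl := List.length_eq_zero_iff.1 hb
        obtain ⟨e₁, -⟩ := lskew_inj e (by simp at l₂ ⊢; omega)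
        refine ⟨α₁, ?_, rfl⟩
        rw [e₁, lcompl_lcompl]
        exact h₁
      -- When `β₂` is nonempty, `α₂` contains the raised last entry `y + 1`, so `y + 1 ≤ |β₂|`. The
      -- raised first entry `x + 1` lies above `α₂` or is its head, so `|β₂| ≤ x + 1`.
      · exfalso
        have hhead : (lskew d [0]).head? = some (x + 1) := by
          simp [lskew, List.head?_append, hx]
        obtain ⟨t, rfl⟩ := h₂.exists_cons
        rw [e] at hhead
        have hxb : (β₂.length : ℤ) ≤ x + 1 := by
          rcases hβ : β₁ with _ | ⟨z, s⟩
          · simp [hβ, lskew, lcompl] at hhead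
            omega
          · have := (h₁.mem_bounds.1 z (by simp [hβ]))
            simp [hβ, lskew, lcompl] at hhead this l₂
            omega
        have hyb : y + 1 ≤ β₂.length := by
          refine (h₂.mem_bounds.2 (y + 1) ?_).2
          obtain ⟨d', rfl⟩ : ∃ d', d = d' ++ [y] := by
            exact ⟨d.dropLast, (List.dropLast_append_getLast? y hy).symm⟩
          have ed : List.drop β₁.length (lskew (d' ++ [y]) [0]) = (β₂.length : ℤ) :: t := by
            rw [e, lskew, List.drop_left' (by simp)]
          rw [← ed, lskew, List.map_append, List.append_assoc, List.drop_append_of_le_length]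
          · simp
          · simp only [List.length_append, List.length_map, List.length_singleton] at hl ⊢
            omega
        omega
  · rintro ⟨a, ha, rfl⟩
    have := Threads.node ha .nil
    rwa [lcompl_lcompl] at this

/-! ### Layered permutations in one-line notation -/

theorem permList_skewSum {n m : ℕ} (π : Perm (Fin n)) (σ : Perm (Fin m)) :
    permList (skewSum π σ) = lskew (permList π) (permList σ) := by
  rw [permList, List.ofFn_add, lskew, permList, permList, List.map_ofFn]
  congr 2
  · funext i
    rw [show Fin.castLE (Nat.le_add_right n m) i = Fin.castAdd m i from rfl]
    simp [skewSum, add_comm]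
  · funext i
    simp [skewSum]

theorem permList_directSum {n m : ℕ} (π : Perm (Fin n)) (σ : Perm (Fin m)) :
    permList (directSum π σ) = ldirect (permList π) (permList σ) := by
  rw [permList, List.ofFn_add, ldirect, permList, permList, List.map_ofFn]
  congr 2
  · funext i
    rw [show Fin.castLE (Nat.le_add_right n m) i = Fin.castAdd m i from rfl]
    simp [directSum]
  · funext i
    simp [directSum, add_comm]

theorem permList_incPerm (n : ℕ) : permList (incPerm n) = lincr n := by
  apply List.ext_getElem <;> simp [permList, incPerm, lincr]

theorem permList_decPerm (n : ℕ) : permList (decPerm n) = lcompl (lincr n) := by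
  apply List.ext_getElem
  · simp
  · intro i h₁ h₂
    simp at h₁
    simp [permList, decPerm, lincr, lcompl, Fin.val_rev]
    omega

theorem permList_upLayered (k : ℕ) (l : List ℕ) :
    permList (upLayered (k :: l)) = lskew (lincr k) (permList (upLayered l)) := by
  rw [← permList_incPerm, ← permList_skewSum]
  rfl

theorem permList_downLayered (k : ℕ) (l : List ℕ) :
    permList (downLayered (k :: l)) = ldirect (lcompl (lincr k)) (permList (downLayered l)) := by
  rw [← permList_decPerm, ← permList_directSum]
  rfl

theorem lcompl_downLayered (l : List ℕ) :
    lcompl (permList (downLayered l)) = permList (upLayered l) := by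
  induction l with
  | nil => rfl
  | cons k l ih =>
    rw [permList_downLayered, permList_upLayered, lcompl_ldirect, lcompl_lcompl, ih]

theorem encard_threads_upLayered (l : List ℕ) (hl : ∀ k ∈ l, 0 < k) :
    {α | Threads (permList (upLayered l)) α}.encard =
      ((l.map fun k => motzkin (k - 1)).prod : ℕ) := by
  induction l with
  | nil =>
    rw [show permList (upLayered []) = [] by rfl, setOf_threads_nil]
    simp
  | cons k l ih =>
    obtain ⟨k, rfl⟩ : ∃ j, k = j + 1 := ⟨k - 1, by have := hl k (by simp); omega⟩
    rw [permList_upLayered, encard_threads_lskew_lincr, encard_threads_lcompl_lincr,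
      ih fun j hj => hl j (by simp [hj])]
    simp

theorem motzkin_prod_ne_zero (l : List ℕ) :
    (((l.map fun k => motzkin (k - 1)).prod : ℕ) : ℕ∞) ≠ 0 := by
  rw [Nat.cast_ne_zero, Ne, List.prod_eq_zero_iff]
  simp only [List.mem_map, not_exists, not_and]
  intro k _
  exact (motzkin_pos _).ne'

theorem isOddThread_of_encard {b : ℕ} {β : Perm (Fin b)}
    (h : (evenThreadsEntangledWith β).encard ≠ 0) : IsOddThread β := by
  obtain ⟨α, -, n, π, h₁, -, h₂⟩ := Set.encard_ne_zero.1 h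
  exact ⟨n, π, h₁, h₂⟩

theorem isEvenThread_of_encard {a : ℕ} {α : Perm (Fin a)}
    (h : (oddThreadsEntangledWith α).encard ≠ 0) : IsEvenThread α := by
  obtain ⟨β, -, n, π, h₁, h₂, -⟩ := Set.encard_ne_zero.1 h
  exact ⟨n, π, h₁, h₂⟩

theorem wall_lcompl_lincr (k : ℕ) : wall (lcompl (lincr k)) = lcompl (lincr (k + 2)) := by
  rw [wall, show k + 2 = 1 + (k + 1) by ring, lcompl_lincr_add, lcompl_lincr_add,
    lcompl_lincr_one]

theorem encard_oddThreads_downLayered {l : List ℕ} (hl : 2 ≤ l.length) (hp : ∀ k ∈ l, 0 < k) :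
    (oddThreadsEntangledWith (downLayered l)).encard =
      ((l.map fun k => motzkin (k - 1)).prod : ℕ) := by
  have hu := encard_threads_upLayered l hp
  rw [← lcompl_downLayered] at hu
  rw [encard_oddThreads, ← hu]
  obtain ⟨k, m, l, rfl⟩ : ∃ k m l', l = k :: m :: l' := by
    rcases l with _ | ⟨k, _ | ⟨m, l⟩⟩
    · simp at hl
    · simp at hl
    · exact ⟨k, m, l, rfl⟩
  obtain ⟨k, rfl⟩ : ∃ j, k = j + 1 := ⟨k - 1, by have := hp k (by simp); omega⟩
  have hm := hp m (by simp)
  obtain ⟨y, hy⟩ : ∃ y, (permList (downLayered (m :: l))).getLast? = some y := by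
    refine ⟨_, List.getLast?_eq_some_getLast fun h => ?_⟩
    have := congrArg List.length h
    rw [length_permList, List.sum_cons, List.length_nil] at this
    omega
  have hy0 : 0 ≤ y := by
    have := List.mem_of_getLast? hy
    simp only [permList, List.mem_ofFn] at this
    omega
  -- The first block now has length `k + 1`: it starts with `k`, and all later entries are raised by
  -- `k + 1`.
  refine encard_threads_wall (x := k) (y := y + (k + 1)) ?_ ?_ (by omega)
  · rw [permList_downLayered, lincr_succ]
    simp [ldirect, lcompl]
  · rw [permList_downLayered, ldirect, List.getLast?_append, List.getLast?_map, hy]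
    simp

end SnowLeopard

theorem mainTheorem7 :
    (∀ l : List ℕ, l ≠ [] → (∀ k ∈ l, 0 < k) →
      SnowLeopard.IsOddThread (SnowLeopard.upLayered l) ∧
      (SnowLeopard.evenThreadsEntangledWith (SnowLeopard.upLayered l)).encard =
        ((l.map fun k => SnowLeopard.motzkin (k - 1)).prod : ℕ)) ∧
    (∀ l : List ℕ, 2 ≤ l.length → (∀ k ∈ l, 0 < k) →
      SnowLeopard.IsEvenThread (SnowLeopard.downLayered l) ∧
      (SnowLeopard.oddThreadsEntangledWith (SnowLeopard.downLayered l)).encard =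
        ((l.map fun k => SnowLeopard.motzkin (k - 1)).prod : ℕ)) ∧
    (∀ k : ℕ, 0 < k →
      SnowLeopard.IsEvenThread (SnowLeopard.downLayered [k]) ∧
      (SnowLeopard.oddThreadsEntangledWith (SnowLeopard.downLayered [k])).encard =
        (SnowLeopard.motzkin (k + 1) : ℕ)) := by
  refine ⟨fun l hl hp => ?_, fun l hl hp => ?_, fun k _ => ?_⟩
  · have hs : 0 < l.sum := by
      obtain ⟨k, t, rfl⟩ := List.exists_cons_of_ne_nil hl
      have := hp k (by simp)
      simp only [List.sum_cons]
      omega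
    have h := SnowLeopard.encard_evenThreads (SnowLeopard.upLayered l) hs
    rw [SnowLeopard.encard_threads_upLayered l hp] at h
    exact ⟨SnowLeopard.isOddThread_of_encard (h ▸ SnowLeopard.motzkin_prod_ne_zero l), h⟩
  · have h := SnowLeopard.encard_oddThreads_downLayered hl hp
    exact ⟨SnowLeopard.isEvenThread_of_encard (h ▸ SnowLeopard.motzkin_prod_ne_zero l), h⟩
  · have h : (SnowLeopard.oddThreadsEntangledWith (SnowLeopard.downLayered [k])).encard =
        (SnowLeopard.motzkin (k + 1) : ℕ) := by
      rw [SnowLeopard.encard_oddThreads, SnowLeopard.permList_downLayered,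
        show SnowLeopard.permList (SnowLeopard.downLayered []) = [] by rfl, SnowLeopard.ldirect,
        List.map_nil, List.append_nil, SnowLeopard.wall_lcompl_lincr,
        SnowLeopard.encard_threads_lcompl_lincr]
    refine ⟨SnowLeopard.isEvenThread_of_encard ?_, h⟩
    rw [h, Nat.cast_ne_zero]
    exact (SnowLeopard.motzkin_pos _).ne'
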